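/- **Proposition 6.1.** Let $\mathfrak g$ be a finite-dimensional simple complex Lie algebra, with a fixed Cartan subalgebra $\mathfrak h$ and a fixed base of its root system $\Phi\subset\mathfrak h^*$. Order the roots by $\alpha\le\beta$ if and only if $\beta-\alpha$ is a sum of (zero or more, possibly repeated) simple roots. A root is *long* if its length, with respect to a Weyl-invariant inner product, is maximal among all roots (so all roots are long in the simply laced case). Let $k\ge 1$ and let $\beta_1,\dots,\beta_k\in\Phi$ be such that * $\beta_1=\alpha_0$ is the highest root; * for $1\le i<k$, $\beta_{i+1}$ is a highest long root orthogonal to $\beta_1,\dots,\beta_i$, that is, a maximal element, for the order above, of the set of long roots orthogonal to $\beta_1,\dots,\beta_i$ (there may be several such elements, and any of them is allowed). Put $\sigma_i=\beta_1+\cdots+\beta_i$. If $\sigma_i$ is a dominant weight for every $1\le i\le k$, then $\sigma_k$ is the highest weight of an irreducible component of $S^k\mathfrak g$: the $k$-th symmetric power $S^k\mathfrak g$ of the adjoint representation contains an irreducible $\mathfrak g$-submodule $W$ with highest weight $\sigma_k$, i.e. an irreducible submodule $W$ containing a nonzero vector of weight $\sigma_k$ that is annihilated by all positive root spaces. -/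

import Mathlib

namespace SymLie

/-- The algebra map from the symmetric algebra of `M` to its dual numbers extending
`x ↦ x + ε f(x)`; its `ε`-component is the derivation extending `f`. -/
noncomputable def symAux {R M : Type*} [CommRing R] [AddCommGroup M] [Module R M]
    (f : M →ₗ[R] M) :
    SymmetricAlgebra R M →ₐ[R] TrivSqZeroExt (SymmetricAlgebra R M) (SymmetricAlgebra R M) :=
  SymmetricAlgebra.lift
    ((TrivSqZeroExt.inlAlgHom R (SymmetricAlgebra R M) (SymmetricAlgebra R M)).toLinearMap ∘ₗ
        SymmetricAlgebra.ι R M +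
      ((TrivSqZeroExt.inrHom (SymmetricAlgebra R M) (SymmetricAlgebra R M)).restrictScalars R) ∘ₗ
        SymmetricAlgebra.ι R M ∘ₗ f)

theorem symAux_ι {R M : Type*} [CommRing R] [AddCommGroup M] [Module R M]
    (f : M →ₗ[R] M) (x : M) :
    symAux f (SymmetricAlgebra.ι R M x) =
      TrivSqZeroExt.inl (SymmetricAlgebra.ι R M x) +
        TrivSqZeroExt.inr (SymmetricAlgebra.ι R M (f x)) := by
  simp [symAux]

theorem fst_symAux {R M : Type*} [CommRing R] [AddCommGroup M] [Module R M]
    (f : M →ₗ[R] M) (a : SymmetricAlgebra R M) : (symAux f a).fst = a := by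
  have h : (TrivSqZeroExt.fstHom R (SymmetricAlgebra R M) (SymmetricAlgebra R M)).comp (symAux f)
      = AlgHom.id R (SymmetricAlgebra R M) := by
    apply SymmetricAlgebra.algHom_ext
    ext x
    simp [symAux_ι]
  exact DFunLike.congr_fun h a

/-- The derivation of the symmetric algebra of `M` that extends the linear map `f : M → M`. -/
noncomputable def symDer {R M : Type*} [CommRing R] [AddCommGroup M] [Module R M]
    (f : M →ₗ[R] M) : Derivation R (SymmetricAlgebra R M) (SymmetricAlgebra R M) :=
  Derivation.mk'
    { toFun := fun a => (symAux f a).snd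
      map_add' := by simp
      map_smul' := by simp }
    (by intro a b; simp [fst_symAux, mul_comm])

theorem symDer_ι {R M : Type*} [CommRing R] [AddCommGroup M] [Module R M]
    (f : M →ₗ[R] M) (x : M) :
    symDer f (SymmetricAlgebra.ι R M x) = SymmetricAlgebra.ι R M (f x) := by
  change (symAux f _).snd = _
  simp [symAux_ι]

theorem derivation_ext {R M : Type*} [CommRing R] [AddCommGroup M] [Module R M]
    {D E : Derivation R (SymmetricAlgebra R M) (SymmetricAlgebra R M)}
    (h : ∀ x, D (SymmetricAlgebra.ι R M x) = E (SymmetricAlgebra.ι R M x)) : D = E := by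
  ext a
  induction a using SymmetricAlgebra.induction with
  | algebraMap r => simp
  | ι x => exact h x
  | mul a b ha hb => simp [ha, hb]
  | add a b ha hb => simp [ha, hb]

/-- The Lie algebra homomorphism `L → Der (S M)` induced by a representation `M` of `L`. -/
noncomputable def symHom (R L M : Type*) [CommRing R] [LieRing L] [LieAlgebra R L]
    [AddCommGroup M] [Module R M] [LieRingModule L M] [LieModule R L M] :
    L →ₗ⁅R⁆ Derivation R (SymmetricAlgebra R M) (SymmetricAlgebra R M) where
  toFun x := symDer (LieModule.toEnd R L M x)
  map_add' x y := derivation_ext fun m => by simp [symDer_ι]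
  map_smul' r x := derivation_ext fun m => by simp [symDer_ι]
  map_lie' {x y} := derivation_ext fun m => by
    simp [symDer_ι, Derivation.commutator_apply]

/-- `L` acts on the symmetric algebra of a representation `M` by derivations. -/
noncomputable instance instLieRingModule {R L M : Type*} [CommRing R] [LieRing L] [LieAlgebra R L]
    [AddCommGroup M] [Module R M] [LieRingModule L M] [LieModule R L M] :
    LieRingModule L (SymmetricAlgebra R M) :=
  LieRingModule.compLieHom (SymmetricAlgebra R M) (symHom R L M)

instance instLieModule {R L M : Type*} [CommRing R] [LieRing L] [LieAlgebra R L]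
    [AddCommGroup M] [Module R M] [LieRingModule L M] [LieModule R L M] :
    LieModule R L (SymmetricAlgebra R M) :=
  LieModule.compLieHom (SymmetricAlgebra R M) (symHom R L M)

theorem lie_ι {R L M : Type*} [CommRing R] [LieRing L] [LieAlgebra R L]
    [AddCommGroup M] [Module R M] [LieRingModule L M] [LieModule R L M] (x : L) (m : M) :
    ⁅x, SymmetricAlgebra.ι R M m⁆ = SymmetricAlgebra.ι R M ⁅x, m⁆ :=
  symDer_ι (LieModule.toEnd R L M x) m

theorem lie_mul {R L M : Type*} [CommRing R] [LieRing L] [LieAlgebra R L]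
    [AddCommGroup M] [Module R M] [LieRingModule L M] [LieModule R L M] (x : L)
    (a b : SymmetricAlgebra R M) : ⁅x, a * b⁆ = ⁅x, a⁆ * b + a * ⁅x, b⁆ := by
  have h := (symHom R L M x).leibniz a b
  change symHom R L M x (a * b) = symHom R L M x a * b + a * symHom R L M x b
  rw [h, smul_eq_mul, smul_eq_mul]
  ring

theorem lie_one {R L M : Type*} [CommRing R] [LieRing L] [LieAlgebra R L]
    [AddCommGroup M] [Module R M] [LieRingModule L M] [LieModule R L M] (x : L) :
    ⁅x, (1 : SymmetricAlgebra R M)⁆ = 0 :=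
  (symHom R L M x).map_one_eq_zero

/-- The `k`-th symmetric power `S^k M` of a representation `M` of `L`: the homogeneous component of
degree `k` of the symmetric algebra, spanned by the products of `k` elements of `M`, with
`x ∈ L` acting by `x • (m₁ ⋯ m_k) = ∑ i, m₁ ⋯ (x • m_i) ⋯ m_k`. -/
noncomputable def symPow (R L M : Type*) [CommRing R] [LieRing L] [LieAlgebra R L]
    [AddCommGroup M] [Module R M] [LieRingModule L M] [LieModule R L M] (k : ℕ) :
    LieSubmodule R L (SymmetricAlgebra R M) where
  __ := LinearMap.range (SymmetricAlgebra.ι R M) ^ k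
  lie_mem {x m} hm := by
    change m ∈ LinearMap.range (SymmetricAlgebra.ι R M) ^ k at hm
    change ⁅x, m⁆ ∈ LinearMap.range (SymmetricAlgebra.ι R M) ^ k
    induction k generalizing m with
    | zero =>
      rw [pow_zero] at hm
      obtain ⟨r, rfl⟩ := Submodule.mem_one.1 hm
      have h : ⁅x, algebraMap R (SymmetricAlgebra R M) r⁆ = 0 := (symHom R L M x).map_algebraMap r
      rw [h]
      exact Submodule.zero_mem _
    | succ k ih =>
      rw [pow_succ] at hm ⊢
      induction hm using Submodule.mul_induction_on' with
      | mem_mul_mem a ha b hb =>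
        rw [lie_mul]
        refine Submodule.add_mem _ (Submodule.mul_mem_mul (ih ha) hb)
          (Submodule.mul_mem_mul ha ?_)
        obtain ⟨y, rfl⟩ := hb
        exact ⟨⁅x, y⁆, (lie_ι x y).symm⟩
      | add a _ b _ ha hb =>
        rw [lie_add]
        exact Submodule.add_mem _ ha hb

section Roots

variable {ι R M N : Type*} [CommRing R] [AddCommGroup M] [Module R M] [AddCommGroup N] [Module R N]

/-- The usual partial order on roots: `α ≤ β` if `β - α` is a sum of simple roots. -/
def RootLE {P : RootPairing ι R M N} (b : P.Base) (α β : ι) : Prop :=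
  P.root β - P.root α ∈ AddSubmonoid.closure (P.root '' (b.support : Set ι))

/-- `α` is the highest root. -/
def IsHighestRoot {P : RootPairing ι R M N} (b : P.Base) (α : ι) : Prop :=
  ∀ β, RootLE b β α

/-- `α` is a long root: no root has a greater length with respect to the canonical (positive
definite, Weyl group invariant) form. If all roots have the same length, all of them are long. -/
def IsLongRoot [Fintype ι] [CharZero R] [IsDomain R] (P : RootPairing ι R M N)
    [P.IsCrystallographic] (α : ι) : Prop :=
  ∀ β, (P.posRootForm ℤ).rootLength β ≤ (P.posRootForm ℤ).rootLength α

/-- `α` is a highest long root orthogonal to the roots in `S`: it is a maximal element, for the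
partial order on roots, of the set of long roots orthogonal to all roots in `S`. -/
def IsHighestLongRootOrthogonalTo [Fintype ι] [CharZero R] [IsDomain R] {P : RootPairing ι R M N}
    [P.IsCrystallographic] (b : P.Base) (S : Set ι) (α : ι) : Prop :=
  IsLongRoot P α ∧ (∀ γ ∈ S, P.IsOrthogonal α γ) ∧
    ∀ β, IsLongRoot P β → (∀ γ ∈ S, P.IsOrthogonal β γ) → RootLE b α β → β = α

/-- `μ` is a dominant (integral) weight. -/
def IsDominant {P : RootPairing ι R M N} (b : P.Base) (μ : M) : Prop :=
  ∀ i ∈ b.support, ∃ n : ℕ, P.toLinearMap μ (P.coroot i) = n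

end Roots

section HighestWeight

open LieAlgebra LieAlgebra.IsKilling

variable {K L : Type*} [Field K] [CharZero K] [LieRing L] [LieAlgebra K L] [FiniteDimensional K L]
  [IsKilling K L] {H : LieSubalgebra K L} [H.IsCartanSubalgebra]
  [LieModule.IsTriangularizable K H L]
  {V : Type*} [AddCommGroup V] [Module K V] [LieRingModule L V] [LieModule K L V]

/-- `v` is a highest weight vector of weight `μ`: it is nonzero, the Cartan subalgebra acts on it
through `μ`, and it is annihilated by all positive root spaces. -/
structure IsHighestWeightVector (b : (rootSystem H).Base) (μ : Module.Dual K H) (v : V) :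
    Prop where
  ne_zero : v ≠ 0
  lie_cartan : ∀ h : H, ⁅(h : L), v⁆ = μ h • v
  lie_pos : ∀ α : H.root, b.IsPos α → ∀ x ∈ rootSpace H α.1, ⁅x, v⁆ = 0

/-- `W` is an irreducible subrepresentation of `V` with highest weight `μ`. -/
def IsIrreducibleWithHighestWeight (b : (rootSystem H).Base) (W : LieSubmodule K L V)
    (μ : Module.Dual K H) : Prop :=
  LieModule.IsIrreducible K L W ∧ ∃ v ∈ W, IsHighestWeightVector b μ v

end HighestWeight

end SymLie

/-!
Put `S = {β₁, …, βᵢ}`. Because `σᵢ` is dominant and `β₁` is the highest root, the coroot sum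
`∑ β ∈ S, β^∨` grades `L` in degrees `-2, …, 2`, and every positive root has nonnegative degree.
By induction on `i` there is a highest weight vector of weight `σᵢ` in `Sⁱ(L₂)`. Given `F` for
`S`, put `S' = S ∪ {α}`, graded by its own coroot sum. There is a linear map `φ : L₋₂ → Sⁱ(L₂)`
that sends the root vector `v_α` of `-α` to `F` and is `L₀`-equivariant up to the character
`σᵢ₊₁`. Contracting `φ` with the Casimir element in `L₂ ⊗ L₋₂` gives an element of `Sⁱ⁺¹(L₂)` on
which `L₀` acts through `σᵢ₊₁` and which the elements of positive degree annihilate.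

It remains to see that the contraction does not vanish. Regard elements of the symmetric algebra
as polynomial functions through the Killing form, and evaluate at `E = ∑ β ∈ S', v_β`. The
contraction takes the value `∑ β ∈ S', φ(v_β)(E)`. Two summands agree whenever some root `δ` of
degree two pairs to one with both coroots, since an element of `L₀` annihilating `E` then relates
them; as `L` is simple, this connects all of `S'`. So the value is `|S'| F(E)`, and `F(E)` is
unchanged when `v_α` is dropped from `E`.
-/

namespace SymLie

open RootPairing

section Pairing

variable {ι R M N : Type*} [CommRing R] [AddCommGroup M] [Module R M] [AddCommGroup N]
  [Module R N] {P : RootPairing ι R M N}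

theorem RootLE.exists_natCast_eq_sub {b : P.Base} {α β : ι} (f : M →ₗ[R] R)
    (hf : ∀ i ∈ b.support, ∃ n : ℕ, f (P.root i) = n) (h : RootLE b α β) :
    ∃ n : ℕ, f (P.root β) - f (P.root α) = n := by
  have hle : AddSubmonoid.closure (P.root '' (b.support : Set ι)) ≤
      (AddMonoidHom.mrange (Nat.castAddMonoidHom R)).comap f := by
    rw [AddSubmonoid.closure_le]
    rintro _ ⟨i, hi, rfl⟩
    obtain ⟨n, hn⟩ := hf i hi
    exact ⟨n, hn.symm⟩
  obtain ⟨n, hn⟩ := hle h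
  exact ⟨n, by rw [← map_sub]; exact hn.symm⟩

theorem intCast_pairingIn [P.IsCrystallographic] (α β : ι) :
    (P.pairingIn ℤ α β : R) = P.pairing α β :=
  P.algebraMap_pairingIn ℤ α β

variable [CharZero R] [P.IsCrystallographic] {α β γ δ : ι}

theorem pairingIn_eq_sub_of_root_eq_sub (h : P.root δ = P.root α - P.root γ) (β : ι) :
    P.pairingIn ℤ δ β = P.pairingIn ℤ α β - P.pairingIn ℤ γ β :=
  eq_sub_of_add_eq (P.pairingIn_eq_add_of_root_eq_add (eq_sub_iff_add_eq.1 h).symm).symm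

theorem pairingIn_eq_neg_of_root_eq_neg (h : P.root δ = -P.root γ) (β : ι) :
    P.pairingIn ℤ δ β = -P.pairingIn ℤ γ β := by
  apply FaithfulSMul.algebraMap_injective ℤ R
  rw [map_neg, P.algebraMap_pairingIn, P.algebraMap_pairingIn, ← P.root_coroot_eq_pairing, h,
    map_neg, LinearMap.neg_apply, P.root_coroot_eq_pairing]

theorem pairingIn_eq_zero_of_isOrthogonal (h : P.IsOrthogonal α β) : P.pairingIn ℤ α β = 0 := by
  rw [← Int.cast_inj (α := R), intCast_pairingIn, h.1, Int.cast_zero]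

theorem rootLength_reflectionPerm (B : P.RootPositiveForm ℤ) (α γ : ι) :
    B.rootLength (P.reflectionPerm α γ) = B.rootLength γ := by
  apply FaithfulSMul.algebraMap_injective ℤ R
  simp only [B.algebraMap_rootLength, P.root_reflectionPerm]
  exact B.isOrthogonal_reflection α _ _

theorem isDominant_sum_root_iff {b : P.Base} {S : Finset ι} :
    IsDominant b (∑ β ∈ S, P.root β) ↔ ∀ i ∈ b.support, 0 ≤ ∑ β ∈ S, P.pairingIn ℤ β i := by
  refine forall₂_congr fun i _ ↦ ?_
  have hsum : P.toLinearMap (∑ β ∈ S, P.root β) (P.coroot i) =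
      ((∑ β ∈ S, P.pairingIn ℤ β i : ℤ) : R) := by
    simp [LinearMap.sum_apply, intCast_pairingIn]
  rw [hsum]
  refine ⟨fun ⟨n, hn⟩ ↦ ?_, fun h ↦ ?_⟩
  · rw [← Int.cast_natCast, Int.cast_inj] at hn
    lia
  · exact ⟨_, by rw [← Int.cast_natCast, Int.toNat_of_nonneg h]⟩

end Pairing

section LongRoots

variable {ι R M N : Type*} [Fintype ι] [CommRing R] [CharZero R] [IsDomain R] [AddCommGroup M]
  [Module R M] [AddCommGroup N] [Module R N] {P : RootPairing ι R M N} [P.IsCrystallographic]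
  {α β γ δ : ι}

theorem IsLongRoot.rootLength_eq (hα : IsLongRoot P α) (hβ : IsLongRoot P β) :
    (P.posRootForm ℤ).rootLength α = (P.posRootForm ℤ).rootLength β :=
  le_antisymm (hβ α) (hα β)

theorem IsLongRoot.abs_pairingIn_le_one (hβ : IsLongRoot P β) (h : P.root γ ≠ P.root β)
    (h' : P.root γ ≠ -P.root β) : |P.pairingIn ℤ γ β| ≤ 1 := by
  by_contra! hlt
  refine (hβ γ).not_gt ((P.posRootForm ℤ).rootLength_lt_of_pairingIn_notMem h h' fun hmem ↦ ?_)
  simp only [Set.mem_insert_iff, Set.mem_singleton_iff] at hmem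
  rcases hmem with h | h | h <;> simp [h] at hlt

theorem IsLongRoot.root_sub_root_notMem (hβ : IsLongRoot P β) (hγ : P.pairingIn ℤ γ β ≤ 0) :
    P.root β - P.root γ ∉ Set.range P.root := by
  rintro ⟨ε, hε⟩
  have hεβ := pairingIn_eq_sub_of_root_eq_sub hε β
  rw [P.pairingIn_same] at hεβ
  have hne : P.root ε ≠ P.root β := fun h ↦ P.ne_zero γ (sub_eq_self.1 (hε.symm.trans h))
  have hne' : P.root ε ≠ -P.root β := fun h ↦ by
    have := pairingIn_eq_neg_of_root_eq_neg h β
    rw [P.pairingIn_same] at this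
    lia
  have := abs_le.1 (hβ.abs_pairingIn_le_one hne hne')
  lia

theorem IsLongRoot.pairingIn_eq_pairingIn (hα : IsLongRoot P α) (hβ : IsLongRoot P β)
    (hα₁ : P.pairingIn ℤ δ α = 1) (hβ₁ : P.pairingIn ℤ δ β = 1) :
    P.pairingIn ℤ α δ = P.pairingIn ℤ β δ := by
  have hα' := (P.posRootForm ℤ).pairingIn_mul_eq_pairingIn_mul_swap α δ
  have hβ' := (P.posRootForm ℤ).pairingIn_mul_eq_pairingIn_mul_swap β δ
  rw [hα₁, hα.rootLength_eq hβ] at hα'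
  rw [hβ₁] at hβ'
  exact mul_right_cancel₀ ((P.posRootForm ℤ).rootLength_pos δ).ne' (hα'.symm.trans hβ')

omit [IsDomain R] in
theorem exists_rootLength_eq_and_forall_pairingIn_nonneg (b : P.Base) (γ : ι) :
    ∃ δ, (P.posRootForm ℤ).rootLength δ = (P.posRootForm ℤ).rootLength γ ∧
      ∀ i ∈ b.support, 0 ≤ P.pairingIn ℤ δ i := by
  obtain ⟨δ, hδ, hmax⟩ := Set.exists_max_image
    {δ | (P.posRootForm ℤ).rootLength δ = (P.posRootForm ℤ).rootLength γ} b.height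
    (Set.toFinite _) ⟨γ, rfl⟩
  refine ⟨δ, hδ, fun i hi ↦ ?_⟩
  have hreflect : P.root (P.reflectionPerm i δ) = P.root δ + (-P.pairingIn ℤ δ i) • P.root i := by
    rw [P.root_reflectionPerm, P.reflection_apply_root, ← P.algebraMap_pairingIn ℤ, sub_eq_add_neg,
      neg_smul, algebraMap_smul]
  have hle := hmax (P.reflectionPerm i δ) ((rootLength_reflectionPerm _ i δ).trans hδ)
  rw [b.height_add_zsmul hreflect, Base.height_one_of_mem_support hi] at hle
  simpa using hle

omit [IsDomain R] in
theorem RootLE.exists_natCast_eq_form_sub {b : P.Base} (hγ : ∀ i ∈ b.support, 0 ≤ P.pairingIn ℤ γ i)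
    (h : RootLE b α β) :
    ∃ n : ℕ, 2 * (P.posRootForm ℤ).form (P.root γ) (P.root β) -
      2 * (P.posRootForm ℤ).form (P.root γ) (P.root α) = n := by
  refine h.exists_natCast_eq_sub ((2 : R) • (P.posRootForm ℤ).form (P.root γ)) fun i hi ↦ ?_
  obtain ⟨n, hn⟩ := Int.eq_ofNat_of_zero_le
    (mul_nonneg (hγ i hi) ((P.posRootForm ℤ).rootLength_pos i).le)
  refine ⟨n, ?_⟩
  rw [LinearMap.smul_apply, smul_eq_mul, (P.posRootForm ℤ).two_mul_apply_root_root,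
    ← (P.posRootForm ℤ).algebraMap_rootLength, ← P.algebraMap_pairingIn ℤ, ← map_mul, hn]
  simp

theorem IsHighestRoot.isLongRoot {b : P.Base} (h : IsHighestRoot b α)
    (hα : ∀ i ∈ b.support, 0 ≤ P.pairingIn ℤ α i) : IsLongRoot P α := by
  intro γ
  obtain ⟨δ, hδ, hdom⟩ := exists_rootLength_eq_and_forall_pairingIn_nonneg b γ
  obtain ⟨n, hn⟩ := (h δ).exists_natCast_eq_form_sub hα
  obtain ⟨m, hm⟩ := (h δ).exists_natCast_eq_form_sub hdom
  have hsymm := (P.posRootForm ℤ).symm.eq (P.root α) (P.root δ)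
  rw [RingHom.id_apply] at hsymm
  have key : 2 * ((P.posRootForm ℤ).rootLength α - (P.posRootForm ℤ).rootLength δ) =
      ((n + m : ℕ) : ℤ) := by
    apply FaithfulSMul.algebraMap_injective ℤ R
    rw [map_natCast, Nat.cast_add, ← hn, ← hm, map_mul, map_sub,
      (P.posRootForm ℤ).algebraMap_rootLength, (P.posRootForm ℤ).algebraMap_rootLength,
      map_ofNat, hsymm]
    ring
  lia

end LongRoots

section Cascades

theorem exists_eq_neg_one_of_sum_eq_neg_one {ι : Type*} {s : Finset ι} {f : ι → ℤ}
    (hf : ∀ i ∈ s, f i ≤ 0) (hsum : ∑ i ∈ s, f i = -1) :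
    ∃ j ∈ s, f j = -1 ∧ ∀ i ∈ s, i ≠ j → f i = 0 := by
  classical
  obtain ⟨j, hj, hj₀⟩ : ∃ j ∈ s, f j ≠ 0 := by
    by_contra! h
    simp [Finset.sum_eq_zero h] at hsum
  have hle : ∀ i ∈ s.erase j, f i ≤ 0 := fun i hi ↦ hf i (Finset.mem_of_mem_erase hi)
  have hadd := Finset.add_sum_erase s f hj
  have hnonpos := Finset.sum_nonpos hle
  have hfj := hf j hj
  refine ⟨j, hj, by lia, fun i hi hij ↦ ?_⟩
  exact (Finset.sum_eq_zero_iff_of_nonpos hle).1 (by lia) i (Finset.mem_erase.2 ⟨hij, hi⟩)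

variable {ι R M N : Type*} [CommRing R] [AddCommGroup M] [Module R M] [AddCommGroup N]
  [Module R N] {P : RootPairing ι R M N} [P.IsCrystallographic] {S : Finset ι} {α β γ δ : ι}

/-- The pairing of the root `γ` with the sum of the coroots of the roots in `S`. -/
noncomputable def corootDegree (P : RootPairing ι R M N) [P.IsCrystallographic] (S : Finset ι)
    (γ : ι) : ℤ :=
  ∑ β ∈ S, P.pairingIn ℤ γ β

theorem corootDegree_cons (hα : α ∉ S) (γ : ι) :
    corootDegree P (S.cons α hα) γ = P.pairingIn ℤ γ α + corootDegree P S γ := by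
  rw [corootDegree, Finset.sum_cons, corootDegree]

variable [CharZero R]

theorem corootDegree_add (h : P.root δ = P.root α + P.root γ) :
    corootDegree P S δ = corootDegree P S α + corootDegree P S γ := by
  simp only [corootDegree, ← Finset.sum_add_distrib, P.pairingIn_eq_add_of_root_eq_add h]

theorem corootDegree_sub (h : P.root δ = P.root α - P.root γ) :
    corootDegree P S δ = corootDegree P S α - corootDegree P S γ := by
  simp only [corootDegree, ← Finset.sum_sub_distrib, pairingIn_eq_sub_of_root_eq_sub h]

theorem corootDegree_neg (h : P.root δ = -P.root γ) :
    corootDegree P S δ = -corootDegree P S γ := by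
  simp only [corootDegree, ← Finset.sum_neg_distrib, pairingIn_eq_neg_of_root_eq_neg h]

variable [Fintype ι] [IsDomain R]

/-- `S` consists of pairwise orthogonal long roots. -/
structure IsLongOrthogonal (P : RootPairing ι R M N) [P.IsCrystallographic] (S : Finset ι) :
    Prop where
  long : ∀ β ∈ S, IsLongRoot P β
  isOrthogonal : (S : Set ι).Pairwise P.IsOrthogonal

/-- The sets of roots to which the induction applies: pairwise orthogonal long roots such that the
sum of their coroots grades the Lie algebra with degrees at most two. -/
structure IsCascade (P : RootPairing ι R M N) [P.IsCrystallographic] (S : Finset ι) : Prop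
    extends IsLongOrthogonal P S where
  corootDegree_le_two : ∀ γ, corootDegree P S γ ≤ 2

namespace IsLongOrthogonal

theorem cons {hα : α ∉ S} (hS : IsLongOrthogonal P S) (hlong : IsLongRoot P α)
    (hort : ∀ γ ∈ S, P.IsOrthogonal α γ) : IsLongOrthogonal P (S.cons α hα) where
  long := by simpa using ⟨hlong, hS.long⟩
  isOrthogonal := by
    rw [Finset.coe_cons, Set.pairwise_insert]
    exact ⟨hS.isOrthogonal, fun γ hγ _ ↦ ⟨hort γ hγ, (hort γ hγ).symm⟩⟩

variable (hS : IsLongOrthogonal P S)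
include hS

theorem pairingIn_eq_zero (hα : α ∈ S) (hβ : β ∈ S) (h : α ≠ β) : P.pairingIn ℤ α β = 0 :=
  pairingIn_eq_zero_of_isOrthogonal (hS.isOrthogonal hα hβ h)

theorem corootDegree_eq_two (hβ : β ∈ S) : corootDegree P S β = 2 := by
  rw [corootDegree, Finset.sum_eq_single_of_mem β hβ fun γ hγ h ↦
    hS.pairingIn_eq_zero hβ hγ h.symm, P.pairingIn_same]

theorem abs_pairingIn_le_one (hγ : corootDegree P S γ = 0) (hβ : β ∈ S) :
    |P.pairingIn ℤ γ β| ≤ 1 := by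
  have hβ₂ := hS.corootDegree_eq_two hβ
  apply (hS.long β hβ).abs_pairingIn_le_one
  · intro h
    rw [P.root.injective h] at hγ
    lia
  · intro h
    have := corootDegree_neg (S := S) h
    lia

theorem exists_corootDegree_mul_eq :
    ∃ c : ℤ, 0 < c ∧ ∀ γ, corootDegree P S γ * c =
      (∑ β ∈ S, P.pairingIn ℤ β γ) * (P.posRootForm ℤ).rootLength γ := by
  rcases S.eq_empty_or_nonempty with rfl | ⟨α, hα⟩
  · exact ⟨1, one_pos, by simp [corootDegree]⟩
  · refine ⟨_, (P.posRootForm ℤ).rootLength_pos α, fun γ ↦ ?_⟩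
    rw [corootDegree, Finset.sum_mul, Finset.sum_mul]
    refine Finset.sum_congr rfl fun β hβ ↦ ?_
    rw [(hS.long α hα).rootLength_eq (hS.long β hβ)]
    exact (P.posRootForm ℤ).pairingIn_mul_eq_pairingIn_mul_swap β γ

theorem sum_pairingIn_eq_zero (hγ : corootDegree P S γ = 0) :
    ∑ β ∈ S, P.pairingIn ℤ β γ = 0 := by
  obtain ⟨c, -, hc⟩ := hS.exists_corootDegree_mul_eq
  have h := hc γ
  rw [hγ, zero_mul, eq_comm, mul_eq_zero] at h
  exact h.resolve_right ((P.posRootForm ℤ).rootLength_pos γ).ne'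

theorem corootDegree_nonneg_of_mem_support {b : P.Base} (hdom : IsDominant b (∑ β ∈ S, P.root β))
    {i : ι} (hi : i ∈ b.support) : 0 ≤ corootDegree P S i := by
  obtain ⟨c, hc₀, hc⟩ := hS.exists_corootDegree_mul_eq
  refine nonneg_of_mul_nonneg_left ?_ hc₀
  rw [hc]
  exact mul_nonneg (isDominant_sum_root_iff.1 hdom i hi) ((P.posRootForm ℤ).rootLength_pos i).le

theorem corootDegree_nonneg [P.IsReduced] {b : P.Base}
    (hdom : IsDominant b (∑ β ∈ S, P.root β)) (hα : b.IsPos α) : 0 ≤ corootDegree P S α := by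
  refine hα.induction_on_add (fun i hi ↦ hS.corootDegree_nonneg_of_mem_support hdom hi)
    fun i j k hk hi hj ↦ ?_
  rw [corootDegree_add hk]
  exact add_nonneg hi (hS.corootDegree_nonneg_of_mem_support hdom hj)

theorem isCascade {b : P.Base} (hα : α ∈ S) (hhigh : IsHighestRoot b α)
    (hdom : IsDominant b (∑ β ∈ S, P.root β)) : IsCascade P S := by
  refine ⟨hS, fun γ ↦ ?_⟩
  have hdeg : ∀ γ, P.toLinearMap.flip (∑ β ∈ S, P.coroot β) (P.root γ) =
      (corootDegree P S γ : R) := by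
    simp [corootDegree, intCast_pairingIn]
  obtain ⟨n, hn⟩ := (hhigh γ).exists_natCast_eq_sub (P.toLinearMap.flip (∑ β ∈ S, P.coroot β))
    fun i hi ↦ by
      obtain ⟨n, hn⟩ := Int.eq_ofNat_of_zero_le (hS.corootDegree_nonneg_of_mem_support hdom hi)
      exact ⟨n, by rw [hdeg, hn, Int.cast_natCast]⟩
  rw [hdeg, hdeg, hS.corootDegree_eq_two hα, ← Int.cast_sub, ← Int.cast_natCast,
    Int.cast_inj] at hn
  lia

end IsLongOrthogonal

namespace IsCascade

section

variable (hS : IsCascade P S)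
include hS

theorem pairingIn_nonneg (hγ : corootDegree P S γ = 2) (hβ : β ∈ S) : 0 ≤ P.pairingIn ℤ γ β := by
  by_contra! hneg
  have hβ₂ := hS.corootDegree_eq_two hβ
  have hne : P.root γ ≠ -P.root β := fun h ↦ by
    have := corootDegree_neg (S := S) h
    lia
  obtain ⟨ε, hε⟩ := P.root_add_root_mem_of_pairingIn_neg hneg hne
  have hε₂ := hS.corootDegree_le_two ε
  rw [corootDegree_add hε] at hε₂
  lia

theorem neg_two_le_corootDegree (γ : ι) : -2 ≤ corootDegree P S γ := by
  have h := hS.corootDegree_le_two (P.reflectionPerm γ γ)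
  rw [corootDegree_neg (γ := γ) (by simp)] at h
  lia

theorem exists_root_eq_sub (hγ : corootDegree P S γ = 0) (hβ : β ∈ S)
    (hγβ : P.pairingIn ℤ γ β = 1) :
    ∃ δ, P.root δ = P.root β - P.root γ ∧ corootDegree P S δ = 2 := by
  have hne : β ≠ γ := by
    rintro rfl
    simp at hγβ
  have hpos : 0 < P.pairingIn ℤ β γ := by
    rw [P.zero_lt_pairingIn_iff']
    lia
  obtain ⟨δ, hδ⟩ := P.root_sub_root_mem_of_pairingIn_pos hpos hne
  refine ⟨δ, hδ, ?_⟩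
  rw [corootDegree_sub hδ, hS.corootDegree_eq_two hβ, hγ, sub_zero]

theorem exists_pairingIn_eq_neg_one (hγ : corootDegree P S γ = 0) (hβ : β ∈ S)
    (hγβ : P.pairingIn ℤ γ β = 1) :
    ∃ β' ∈ S, β' ≠ β ∧ P.pairingIn ℤ γ β' = -1 ∧
      (∀ α ∈ S, α ≠ β → α ≠ β' → P.pairingIn ℤ γ α = 0) ∧
      ∃ δ, corootDegree P S δ = 2 ∧ P.pairingIn ℤ δ β = 1 ∧ P.pairingIn ℤ δ β' = 1 := by
  classical
  obtain ⟨δ, hδ, hδ₂⟩ := hS.exists_root_eq_sub hγ hβ hγβ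
  have hδ_pairing := fun α ↦ pairingIn_eq_sub_of_root_eq_sub hδ α
  have hle : ∀ α ∈ S.erase β, P.pairingIn ℤ γ α ≤ 0 := by
    intro α hα
    obtain ⟨hne, hα⟩ := Finset.mem_erase.1 hα
    have h := hS.pairingIn_nonneg hδ₂ hα
    rw [hδ_pairing, hS.pairingIn_eq_zero hβ hα hne.symm] at h
    lia
  have hsum : ∑ α ∈ S.erase β, P.pairingIn ℤ γ α = -1 := by
    have h := Finset.add_sum_erase S (P.pairingIn ℤ γ) hβ
    simp only [corootDegree] at hγ
    lia
  obtain ⟨β', hβ', hγβ', hzero⟩ := exists_eq_neg_one_of_sum_eq_neg_one hle hsum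
  obtain ⟨hne, hβ'S⟩ := Finset.mem_erase.1 hβ'
  refine ⟨β', hβ'S, hne, hγβ', fun α hα hαβ hαβ' ↦
    hzero α (Finset.mem_erase.2 ⟨hαβ, hα⟩) hαβ', δ, hδ₂, ?_, ?_⟩
  · rw [hδ_pairing, hγβ, P.pairingIn_same]
    rfl
  · rw [hδ_pairing, hγβ', hS.pairingIn_eq_zero hβ hβ'S hne.symm]
    rfl

theorem sum_pairingIn_smul_eq_zero {A : Type*} [AddCommGroup A] {f : ι → A}
    (hf : ∀ β ∈ S, ∀ β' ∈ S, ∀ δ, β ≠ β' → corootDegree P S δ = 2 → P.pairingIn ℤ δ β = 1 →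
      P.pairingIn ℤ δ β' = 1 → f β = f β')
    (hγ : corootDegree P S γ = 0) : ∑ β ∈ S, P.pairingIn ℤ γ β • f β = 0 := by
  classical
  by_cases h : ∃ β ∈ S, P.pairingIn ℤ γ β = 1
  · obtain ⟨β, hβ, hγβ⟩ := h
    obtain ⟨β', hβ', hne, hγβ', hzero, δ, hδ, hδβ, hδβ'⟩ :=
      hS.exists_pairingIn_eq_neg_one hγ hβ hγβ
    rw [Finset.sum_eq_add_of_mem β β' hβ hβ' hne.symm fun α hα h ↦ by
      rw [hzero α hα h.1 h.2, zero_smul], hγβ, hγβ', hf β hβ β' hβ' δ hne.symm hδ hδβ hδβ']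
    simp
  · push Not at h
    have hle : ∀ β ∈ S, P.pairingIn ℤ γ β ≤ 0 := fun β hβ ↦ by
      have := abs_le.1 (hS.abs_pairingIn_le_one hγ hβ)
      have := h β hβ
      lia
    refine Finset.sum_eq_zero fun β hβ ↦ ?_
    rw [(Finset.sum_eq_zero_iff_of_nonpos hle).1 hγ β hβ, zero_smul]

end

theorem pairingIn_eq_zero_of_cons {hα : α ∉ S} (hS : IsCascade P (S.cons α hα))
    (hγ : corootDegree P S γ = 2) : P.pairingIn ℤ γ α = 0 := by
  have hαS : α ∈ S.cons α hα := Finset.mem_cons_self α S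
  have hα₂ := hS.corootDegree_eq_two hαS
  have hα₀ : corootDegree P S α = 0 := by
    rw [corootDegree_cons hα, P.pairingIn_same] at hα₂
    lia
  have hne : P.root γ ≠ P.root α := fun h ↦ by
    rw [P.root.injective h] at hγ
    lia
  have hne' : P.root γ ≠ -P.root α := fun h ↦ by
    rw [corootDegree_neg h] at hγ
    lia
  have hle := hS.corootDegree_le_two γ
  rw [corootDegree_cons hα] at hle
  refine le_antisymm (by lia) (not_lt.1 fun hneg ↦ ?_)
  obtain ⟨ε, hε⟩ := P.root_add_root_mem_of_pairingIn_neg hneg hne'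
  have hε₂ := hS.corootDegree_le_two ε
  rw [corootDegree_add hε, hα₂, corootDegree_cons hα] at hε₂
  have := abs_le.1 ((hS.long α hαS).abs_pairingIn_le_one hne hne')
  lia

end IsCascade

end Cascades

section Closure

variable {K V : Type*} [Field K] [AddCommGroup V] [Module K V]

/-- The smallest subspace that contains `U` and is stable under all operators in `T`. -/
def closureUnder (U : Submodule K V) (T : Set (Module.End K V)) : Submodule K V :=
  sInf {X | U ≤ X ∧ ∀ f ∈ T, ∀ x ∈ X, f x ∈ X}

variable {U : Submodule K V} {T : Set (Module.End K V)}

theorem le_closureUnder : U ≤ closureUnder U T :=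
  le_sInf fun _ hX ↦ hX.1

theorem closureUnder_le {X : Submodule K V} (hU : U ≤ X) (hT : ∀ f ∈ T, ∀ x ∈ X, f x ∈ X) :
    closureUnder U T ≤ X :=
  sInf_le ⟨hU, hT⟩

theorem map_mem_closureUnder {f : Module.End K V} (hf : f ∈ T) {x : V}
    (hx : x ∈ closureUnder U T) : f x ∈ closureUnder U T := by
  simp only [closureUnder, Submodule.mem_sInf] at hx ⊢
  exact fun X hX ↦ hX.2 f hf x (hx X hX)

theorem map_mem_closureUnder_of_commutator {G : Set (Module.End K V)}
    (hU : ∀ g ∈ G, ∀ u ∈ U, g u ∈ closureUnder U T)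
    (hG : ∀ g ∈ G, ∀ f ∈ T, ∃ g' ∈ G, ∀ x, g (f x) = f (g x) + g' x)
    {g : Module.End K V} (hg : g ∈ G) {x : V} (hx : x ∈ closureUnder U T) :
    g x ∈ closureUnder U T := by
  let X : Submodule K V := closureUnder U T ⊓ ⨅ g ∈ G, (closureUnder U T).comap g
  have hmem (x : V) : x ∈ X ↔ x ∈ closureUnder U T ∧ ∀ g ∈ G, g x ∈ closureUnder U T := by
    simp [X, Submodule.mem_iInf]
  have hle : closureUnder U T ≤ X := by
    refine closureUnder_le (fun u hu ↦ (hmem u).2 ⟨le_closureUnder hu, fun g hg ↦ hU g hg u hu⟩)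
      fun f hf x hx ↦ ?_
    rw [hmem] at hx ⊢
    refine ⟨map_mem_closureUnder hf hx.1, fun g hg ↦ ?_⟩
    obtain ⟨g', hg', h⟩ := hG g hg f hf
    rw [h]
    exact add_mem (map_mem_closureUnder hf (hx.2 g hg)) (hx.2 g' hg')
  exact ((hmem x).1 (hle hx)).2 g hg

variable {D : Module.End K V} {c e : K}

theorem closureUnder_le_sup_iSup_eigenspace (hU : U ≤ D.eigenspace c)
    (hT : ∀ f ∈ T, ∃ n : ℕ, ∀ x, D (f x) = f (D x) + ((n + 1) * e) • f x) :
    closureUnder U T ≤ U ⊔ ⨆ n : ℕ, D.eigenspace (c + (n + 1) * e) := by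
  refine closureUnder_le le_sup_left fun f hf x hx ↦ ?_
  obtain ⟨n, hn⟩ := hT f hf
  have hshift {a : K} {y : V} (hy : y ∈ D.eigenspace a) :
      f y ∈ D.eigenspace (a + (n + 1) * e) := by
    rw [Module.End.mem_eigenspace_iff] at hy ⊢
    rw [hn, hy, map_smul, add_smul]
  obtain ⟨y, hy, z, hz, rfl⟩ := Submodule.mem_sup.1 hx
  rw [map_add]
  refine Submodule.mem_sup_right (add_mem (Submodule.mem_iSup_of_mem n (hshift (hU hy))) ?_)
  refine (iSup_le fun m y hy ↦ ?_ : _ ≤ Submodule.comap f (⨆ n : ℕ, _)) hz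
  refine Submodule.mem_iSup_of_mem (m + n + 1) ?_
  convert hshift hy using 2
  push_cast
  ring

theorem closureUnder_inf_eigenspace_le [CharZero K] (hU : U ≤ D.eigenspace c) (he : e ≠ 0)
    (hT : ∀ f ∈ T, ∃ n : ℕ, ∀ x, D (f x) = f (D x) + ((n + 1) * e) • f x) :
    closureUnder U T ⊓ D.eigenspace c ≤ U := by
  rintro x ⟨hx, hxc⟩
  obtain ⟨y, hy, z, hz, rfl⟩ :=
    Submodule.mem_sup.1 (closureUnder_le_sup_iSup_eigenspace hU hT hx)
  have hzc : z ∈ D.eigenspace c := (Submodule.add_mem_iff_right _ (hU hy)).1 hxc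
  have hle : ⨆ n : ℕ, D.eigenspace (c + (n + 1) * e) ≤ ⨆ μ, ⨆ (_ : μ ≠ c), D.eigenspace μ := by
    refine iSup_le fun n ↦ le_iSup₂_of_le (c + (n + 1) * e) ?_ le_rfl
    simpa [he] using Nat.cast_add_one_ne_zero n
  have hz₀ : z = 0 := Submodule.disjoint_def.1 (D.eigenspaces_iSupIndep c) z hzc (hle hz)
  rwa [hz₀, add_zero]

end Closure

section RootVectors

open LieAlgebra LieAlgebra.IsKilling LieModule

variable {K L : Type*} [Field K] [LieRing L] [LieAlgebra K L] [FiniteDimensional K L]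
  {H : LieSubalgebra K L} [H.IsCartanSubalgebra]

theorem eq_zero_or_mem_or_exists_root {χ : H → K} {z : L} (hz : z ∈ rootSpace H χ) :
    z = 0 ∨ (χ = 0 ∧ z ∈ H) ∨ ∃ α : H.root, χ = α.1 := by
  by_cases hz₀ : z = 0
  · exact Or.inl hz₀
  by_cases hχ : χ = 0
  · subst hχ
    exact Or.inr (Or.inl ⟨rfl, by simpa using hz⟩)
  let α : Weight K H L := ⟨χ, fun h ↦ hz₀ (by simpa [h] using hz)⟩
  exact Or.inr (Or.inr ⟨⟨α, Finset.mem_filter.2 ⟨Finset.mem_univ _, hχ⟩⟩, rfl⟩)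

variable (H) in
/-- Root vectors `u α` and `v α` for each pair `α`, `-α` of opposite roots that are dual for the
Killing form. -/
structure DualRootVectors where
  u : H.root → L
  v : H.root → L
  u_mem : ∀ α, u α ∈ rootSpace H α.1
  v_mem : ∀ α, v α ∈ rootSpace H (-(α.1 : H → K))
  killingForm_eq_one : ∀ α, killingForm K L (u α) (v α) = 1

namespace DualRootVectors

variable (X : DualRootVectors H)

theorem u_ne_zero (α : H.root) : X.u α ≠ 0 := by
  intro h
  simpa [h] using X.killingForm_eq_one α

theorem v_ne_zero (α : H.root) : X.v α ≠ 0 := by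
  intro h
  simpa [h] using X.killingForm_eq_one α

theorem killingForm_v_u (α : H.root) : killingForm K L (X.v α) (X.u α) = 1 := by
  rw [← X.killingForm_eq_one α]
  exact traceForm_comm K L L _ _

end DualRootVectors

section IsKilling

variable [IsKilling K L]

theorem killingForm_cartanEquivDual_symm (χ : Module.Dual K H) (t : H) :
    killingForm K L ((cartanEquivDual H).symm χ : H) t = χ t :=
  LinearMap.BilinForm.apply_toDual_symm_apply (hB := traceForm_cartan_nondegenerate K L H) _ _

theorem apply_cartanEquivDual_symm_comm (χ ψ : Module.Dual K H) :
    χ ((cartanEquivDual H).symm ψ) = ψ ((cartanEquivDual H).symm χ) := by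
  rw [← killingForm_cartanEquivDual_symm χ, ← killingForm_cartanEquivDual_symm ψ]
  exact traceForm_comm K L L _ _

end IsKilling

variable [IsTriangularizable K H L]

theorem rootSpace_induction {p : L → Prop}
    (mem : ∀ (χ : H → K), ∀ x ∈ rootSpace H χ, p x) (zero : p 0)
    (add : ∀ x y, p x → p y → p (x + y)) (x : L) : p x := by
  have hx : x ∈ ⨆ χ, rootSpace H χ := by simp [iSup_genWeightSpace_eq_top K H L]
  induction hx using LieSubmodule.iSup_induction' with
  | mem χ y hy => exact mem χ y hy
  | zero => exact zero
  | add y z _ _ hy hz => exact add y z hy hz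

theorem DualRootVectors.killingForm_v_eq_zero (X : DualRootVectors H) {α : H.root}
    {χ : H → K} {x : L} (hx : x ∈ rootSpace H χ) (h : χ ≠ α.1) : killingForm K L (X.v α) x = 0 :=
  killingForm_apply_eq_zero_of_mem_rootSpace_of_add_ne_zero K L H (X.v_mem α) hx
    fun h' ↦ h (neg_add_eq_zero.1 h').symm

variable [IsKilling K L]

theorem exists_coe_eq_neg (α : H.root) : ∃ γ : H.root, (γ.1 : H → K) = -(α.1 : H → K) :=
  ⟨⟨-α.1, Finset.mem_filter.2 ⟨Finset.mem_univ _,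
    (LieSubalgebra.isNonZero_coe_root α).neg⟩⟩, Weight.coe_neg⟩

theorem exists_killingForm_eq_one {χ : H → K} {x : L} (hx : x ∈ rootSpace H χ) (hx₀ : x ≠ 0) :
    ∃ y ∈ rootSpace H (-χ), killingForm K L x y = 1 := by
  obtain ⟨y, hy, h⟩ : ∃ y ∈ rootSpace H (-χ), killingForm K L x y ≠ 0 := by
    contrapose! hx₀
    simpa using mem_ker_killingForm_of_mem_rootSpace_of_forall_rootSpace_neg K L H hx hx₀
  exact ⟨(killingForm K L x y)⁻¹ • y, Submodule.smul_mem _ _ hy, by simp [h]⟩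

variable [CharZero K]

theorem two_smul_cartanEquivDual_symm (α : H.root) :
    (2 : K) • (cartanEquivDual H).symm α.1.toLinear =
      α.1 ((cartanEquivDual H).symm α.1.toLinear) • coroot α.1 := by
  have h := root_apply_cartanEquivDual_symm_ne_zero (LieSubalgebra.isNonZero_coe_root α)
  rw [IsKilling.coroot, smul_comm, smul_inv_smul₀ h, ofNat_smul_eq_nsmul]

theorem two_mul_apply_cartanEquivDual_symm (χ : Module.Dual K H) (α : H.root) :
    2 * χ ((cartanEquivDual H).symm α.1.toLinear) =
      α.1 ((cartanEquivDual H).symm α.1.toLinear) * χ (coroot α.1) := by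
  rw [← smul_eq_mul, ← map_smul, two_smul_cartanEquivDual_symm, map_smul, smul_eq_mul]

theorem killingForm_coroot_self (α : H.root) :
    killingForm K L (coroot α.1) (coroot α.1) =
      ((∑ γ : H.root, (rootSystem H).pairingIn ℤ γ α ^ 2 : ℤ) : K) := by
  have h := congrArg (fun B ↦ B (coroot α.1) (coroot α.1))
    (restrict_killingForm_eq_sum (K := K) (L := L) (H := H))
  rw [← Finset.sum_coe_sort] at h
  simp only [LinearMap.sum_apply] at h
  refine h.trans ?_
  push_cast
  refine Finset.sum_congr rfl fun γ _ ↦ ?_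
  rw [intCast_pairingIn, rootSystem_pairing_apply, pow_two]
  rfl

theorem exists_pos_root_apply_cartanEquivDual_symm (α : H.root) :
    ∃ q : ℚ, 0 < q ∧ α.1 ((cartanEquivDual H).symm α.1.toLinear) = q := by
  set A := α.1 ((cartanEquivDual H).symm α.1.toLinear) with hA
  set Q : ℤ := ∑ γ : H.root, (rootSystem H).pairingIn ℤ γ α ^ 2 with hQ
  have hAQ : A * Q = 4 := by
    have htrace := traceForm_coroot α.1 (coroot α.1)
    have hA₀ : A ≠ 0 :=
      root_apply_cartanEquivDual_symm_ne_zero (LieSubalgebra.isNonZero_coe_root α)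
    rw [root_apply_coroot (LieSubalgebra.isNonZero_coe_root α)] at htrace
    rw [hQ, ← killingForm_coroot_self]
    refine (congrArg (A * ·) htrace).trans ?_
    rw [← hA]
    norm_num [mul_left_comm A, hA₀]
  have hQ₀ : Q ≠ 0 := fun h ↦ by norm_num [h] at hAQ
  have hQpos : 0 < Q := (Finset.sum_nonneg fun _ _ ↦ sq_nonneg _).lt_of_ne hQ₀.symm
  refine ⟨4 / Q, div_pos four_pos (by exact_mod_cast hQpos), ?_⟩
  push_cast
  rw [eq_div_iff (by exact_mod_cast hQ₀), hAQ]

instance : Nonempty (DualRootVectors H) := by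
  choose u hu hu₀ using fun α : H.root ↦ α.1.exists_ne_zero
  choose v hv huv using fun α : H.root ↦ exists_killingForm_eq_one (hu α) (hu₀ α)
  exact ⟨⟨u, v, hu, hv, huv⟩⟩

namespace DualRootVectors

variable (X : DualRootVectors H)

theorem lie_u_v (α : H.root) :
    ⁅X.u α, X.v α⁆ = ((cartanEquivDual H).symm α.1.toLinear : H) := by
  rw [lie_eq_killingForm_smul_of_mem_rootSpace_of_mem_rootSpace_neg (X.u_mem α) (X.v_mem α),
    X.killingForm_eq_one, one_smul]

theorem eq_smul_u {α : H.root} {x : L} (hx : x ∈ rootSpace H α.1) :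
    x = killingForm K L (X.v α) x • X.u α := by
  have hrank := finrank_rootSpace_eq_one α.1 (LieSubalgebra.isNonZero_coe_root α)
  obtain ⟨c, hc⟩ := (finrank_eq_one_iff_of_nonzero' (⟨X.u α, X.u_mem α⟩ : rootSpace H α.1)
    (by simpa [LieSubmodule.mk_eq_zero] using X.u_ne_zero α)).1 hrank ⟨x, hx⟩
  replace hc : c • X.u α = x := congrArg Subtype.val hc
  rw [← hc, map_smul, X.killingForm_v_u, smul_eq_mul, mul_one]

theorem eq_smul_v {α : H.root} {x : L} (hx : x ∈ rootSpace H (-(α.1 : H → K))) :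
    x = killingForm K L (X.u α) x • X.v α := by
  have hrank := finrank_rootSpace_eq_one (-α.1) (LieSubalgebra.isNonZero_coe_root α).neg
  rw [Weight.coe_neg] at hrank
  obtain ⟨c, hc⟩ := (finrank_eq_one_iff_of_nonzero'
    (⟨X.v α, X.v_mem α⟩ : rootSpace H (-(α.1 : H → K)))
    (by simpa [LieSubmodule.mk_eq_zero] using X.v_ne_zero α)).1 hrank ⟨x, hx⟩
  replace hc : c • X.v α = x := congrArg Subtype.val hc
  rw [← hc, map_smul, X.killingForm_eq_one, smul_eq_mul, mul_one]

end DualRootVectors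

end RootVectors

section Casimir

open LieAlgebra LieAlgebra.IsKilling LieModule

theorem sum_apply_lie_add_sum_apply_lie_eq_zero {R L W J : Type*} [CommRing R] [LieRing L]
    [LieAlgebra R L] [AddCommGroup W] [Module R W] [Fintype J] {e e' : J → L}
    (B : L →ₗ[R] L →ₗ[R] W) (z : L)
    (he : ∀ j, ∑ i, killingForm R L (e' i) ⁅z, e j⁆ • e i = ⁅z, e j⁆)
    (he' : ∀ j, ∑ i, killingForm R L (e i) ⁅z, e' j⁆ • e' i = ⁅z, e' j⁆) :
    ∑ j, B ⁅z, e j⁆ (e' j) + ∑ j, B (e j) ⁅z, e' j⁆ = 0 := by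
  have h₁ : ∑ j, B ⁅z, e j⁆ (e' j) =
      ∑ j, ∑ i, killingForm R L (e' i) ⁅z, e j⁆ • B (e i) (e' j) := by
    refine Finset.sum_congr rfl fun j _ ↦ ?_
    conv_lhs => rw [← he j]
    simp
  have h₂ : ∑ j, B (e j) ⁅z, e' j⁆ =
      ∑ j, ∑ i, killingForm R L (e i) ⁅z, e' j⁆ • B (e j) (e' i) := by
    refine Finset.sum_congr rfl fun j _ ↦ ?_
    conv_lhs => rw [← he' j]
    simp
  have hinv (i j : J) : killingForm R L (e j) ⁅z, e' i⁆ = -killingForm R L (e' i) ⁅z, e j⁆ :=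
    (traceForm_comm R L L _ _).trans (traceForm_apply_lie_apply' R L L z (e' i) (e j))
  rw [h₁, h₂, Finset.sum_comm, ← Finset.sum_add_distrib]
  refine Finset.sum_eq_zero fun i _ ↦ ?_
  rw [← Finset.sum_add_distrib]
  refine Finset.sum_eq_zero fun j _ ↦ ?_
  rw [hinv, neg_smul, add_neg_cancel]

variable {K L : Type*} [Field K] [LieRing L] [LieAlgebra K L] [FiniteDimensional K L]
  {H : LieSubalgebra K L} [H.IsCartanSubalgebra] [IsKilling K L] [IsTriangularizable K H L]

namespace DualRootVectors

variable (X : DualRootVectors H)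

/-- A basis of `L` that consists of the root vectors `u α` and of a basis of the Cartan
subalgebra. -/
noncomputable def fam : H.root ⊕ Fin (Module.finrank K H) → L :=
  Sum.elim X.u fun i ↦ (Module.finBasis K H i : L)

/-- The basis of `L` dual to `X.fam` for the Killing form. -/
noncomputable def famDual : H.root ⊕ Fin (Module.finrank K H) → L :=
  Sum.elim X.v fun i ↦ ((cartanEquivDual H).symm ((Module.finBasis K H).coord i) : H)

variable [CharZero K]

theorem sum_killingForm_famDual_smul_fam (x : L) :
    ∑ j, killingForm K L (X.famDual j) x • X.fam j = x := by
  induction x using rootSpace_induction (H := H) with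
  | zero => simp
  | add x y hx hy => simp only [map_add, add_smul, Finset.sum_add_distrib, hx, hy]
  | mem χ x hx =>
    rw [Fintype.sum_sum_type]
    simp only [fam, famDual, Sum.elim_inl, Sum.elim_inr]
    rcases eq_zero_or_mem_or_exists_root hx with rfl | ⟨rfl, hxH⟩ | ⟨α, rfl⟩
    · simp
    · rw [Finset.sum_eq_zero, zero_add]
      · have hrepr := congrArg (Subtype.val : H → L) ((Module.finBasis K H).sum_repr ⟨x, hxH⟩)
        rw [AddSubmonoidClass.coe_finsetSum] at hrepr
        exact (Finset.sum_congr rfl fun i _ ↦ congrArg (· • (Module.finBasis K H i : L))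
          (killingForm_cartanEquivDual_symm _ ⟨x, hxH⟩)).trans hrepr
      · intro α _
        rw [X.killingForm_v_eq_zero hx (LieSubalgebra.isNonZero_coe_root α ·.symm), zero_smul]
    · rw [Finset.sum_eq_single_of_mem α (Finset.mem_univ _), Finset.sum_eq_zero, add_zero]
      · exact (X.eq_smul_u hx).symm
      · intro i _
        rw [killingForm_apply_eq_zero_of_mem_rootSpace_of_add_ne_zero K L H (α := 0)
          (by simp) hx (by simp [LieSubalgebra.isNonZero_coe_root α]), zero_smul]
      · intro γ _ hγ
        rw [X.killingForm_v_eq_zero hx fun h ↦ hγ (Subtype.ext (DFunLike.coe_injective h.symm)),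
          zero_smul]

theorem sum_killingForm_fam_smul_famDual (x : L) :
    ∑ j, killingForm K L (X.fam j) x • X.famDual j = x := by
  rw [← sub_eq_zero, ← Submodule.mem_bot K, ← ker_killingForm_eq_bot (R := K) (L := L),
    LinearMap.mem_ker]
  ext y
  have h : killingForm K L x y = ∑ j, killingForm K L (X.fam j) x *
      killingForm K L (X.famDual j) y := by
    conv_lhs => rw [← X.sum_killingForm_famDual_smul_fam y]
    rw [map_sum]
    refine Finset.sum_congr rfl fun j _ ↦ ?_
    rw [map_smul, smul_eq_mul, mul_comm, traceForm_comm K L L x]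
  rw [map_sub, LinearMap.sub_apply, h]
  simp

end DualRootVectors

/-- The Casimir operator of a representation, written in terms of dual bases. -/
noncomputable def casimir (X : DualRootVectors H) (V : Type*) [AddCommGroup V] [Module K V]
    [LieRingModule L V] [LieModule K L V] : Module.End K V :=
  ∑ j, toEnd K L V (X.fam j) ∘ₗ toEnd K L V (X.famDual j)

variable {V : Type*} [AddCommGroup V] [Module K V] [LieRingModule L V] [LieModule K L V]

omit [IsTriangularizable K H L] in
theorem casimir_apply (X : DualRootVectors H) (a : V) :
    casimir X V a = ∑ j, ⁅X.fam j, ⁅X.famDual j, a⁆⁆ := by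
  simp [casimir]

variable [CharZero K]

theorem casimir_lie (X : DualRootVectors H) (z : L) (a : V) :
    casimir X V ⁅z, a⁆ = ⁅z, casimir X V a⁆ := by
  let B : L →ₗ[K] L →ₗ[K] V := LinearMap.mk₂ K (fun x y ↦ ⁅x, ⁅y, a⁆⁆)
    (by simp) (by simp) (by simp) (by simp)
  have h := sum_apply_lie_add_sum_apply_lie_eq_zero B z (e := X.fam) (e' := X.famDual)
    (fun j ↦ X.sum_killingForm_famDual_smul_fam _) (fun j ↦ X.sum_killingForm_fam_smul_famDual _)
  rw [casimir_apply, casimir_apply, lie_sum, ← sub_eq_zero, ← neg_eq_zero, ← h,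
    ← Finset.sum_add_distrib, ← Finset.sum_sub_distrib, ← Finset.sum_neg_distrib]
  refine Finset.sum_congr rfl fun j _ ↦ ?_
  simp only [B, LinearMap.mk₂_apply]
  rw [leibniz_lie z (X.fam j), leibniz_lie z (X.famDual j), lie_add]
  abel

end Casimir

section PositiveRoots

variable {ι R M N : Type*} [CommRing R] [CharZero R] [AddCommGroup M] [Module R M]
  [AddCommGroup N] [Module R N] {P : RootPairing ι R M N} {b : P.Base}

/-- The nonnegative integral combinations of the simple roots. -/
abbrev simpleRootMonoid (b : P.Base) : AddSubmonoid M :=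
  AddSubmonoid.closure (P.root '' (b.support : Set ι))

/-- The sum of the positive roots. -/
noncomputable def twoRho [Fintype ι] (b : P.Base) : M := by
  classical exact ∑ i with b.IsPos i, P.root i

theorem isPos_of_root_eq_neg {α γ : ι} (hα : ¬ b.IsPos α) (h : P.root γ = -P.root α) :
    b.IsPos γ := by
  let := P.indexNeg
  have hγ : γ = -α := by
    rw [← P.root.apply_eq_iff_eq, h, P.indexNeg_neg, P.root_reflectionPerm,
      P.reflection_apply_self]
  rw [hγ]
  exact (Base.IsPos.neg_iff_not b α).2 hα

variable [IsDomain R] [P.IsCrystallographic]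

theorem root_mem_simpleRootMonoid [Finite ι] {α : ι} (hα : b.IsPos α) :
    P.root α ∈ simpleRootMonoid b := by
  refine hα.induction_on_add (p := fun α ↦ P.root α ∈ simpleRootMonoid b)
    (fun i hi ↦ AddSubmonoid.subset_closure ⟨i, hi, rfl⟩) fun i j k hk hi hj ↦ ?_
  rw [hk]
  exact add_mem hi (AddSubmonoid.subset_closure ⟨j, hj, rfl⟩)

theorem toLinearMap_twoRho_coroot [Fintype ι] [P.IsReduced] {i : ι} (hi : i ∈ b.support) :
    P.toLinearMap (twoRho b) (P.coroot i) = 2 := by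
  classical
  have hmem : i ∈ Finset.univ.filter b.IsPos := by
    simpa using Base.isPos_of_mem_support hi
  have hpair (α : ι) : P.pairing (P.reflectionPerm i α) i = -P.pairing α i := by
    rw [← P.pairing_reflectionPerm, P.pairing_reflectionPerm_self_right]
  rw [twoRho, map_sum, LinearMap.sum_apply]
  simp only [P.root_coroot_eq_pairing]
  -- the simple reflection at `i` permutes the positive roots other than `i`
  rw [← Finset.add_sum_erase _ _ hmem, P.pairing_same, add_eq_left]
  refine Finset.sum_involution (fun α _ ↦ P.reflectionPerm i α) (fun α _ ↦ ?_) (fun α _ hα₀ h ↦ ?_)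
    (fun α hα ↦ ?_) fun α _ ↦ P.reflectionPerm_self _ _
  · rw [hpair, add_neg_cancel]
  · have hα := hpair α
    rw [h] at hα
    exact hα₀ (self_eq_neg.1 hα)
  · simp only [Finset.mem_erase, Finset.mem_filter, Finset.mem_univ, true_and] at hα ⊢
    refine ⟨fun h ↦ ?_, hα.2.reflectionPerm hi hα.1⟩
    have hαi : α = P.reflectionPerm i i := by
      rw [← congrArg (P.reflectionPerm i) h, P.reflectionPerm_self]
    have hheight := b.height_reflectionPerm_self i
    have hαpos := hα.2
    have hipos := Base.isPos_of_mem_support hi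
    rw [Base.isPos_iff] at hαpos hipos
    rw [hαi, ← P.indexNeg_neg, hheight] at hαpos
    lia

end PositiveRoots

section CasimirEigenvalue

open LieAlgebra LieAlgebra.IsKilling LieModule

variable {K L : Type*} [Field K] [CharZero K] [LieRing L] [LieAlgebra K L] [FiniteDimensional K L]
  {H : LieSubalgebra K L} [H.IsCartanSubalgebra] [IsKilling K L] [IsTriangularizable K H L]
  {b : (rootSystem H).Base} {lam μ : Module.Dual K H}

/-- The eigenvalue of the Casimir operator on a highest weight vector of weight `μ`. -/
noncomputable def casimirValue (b : (rootSystem H).Base) (μ : Module.Dual K H) : K :=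
  (μ + twoRho b) ((cartanEquivDual H).symm μ)

omit [CharZero K] [IsTriangularizable K H L] in
theorem sum_apply_finBasis_mul_apply (μ : Module.Dual K H) :
    ∑ i, μ (Module.finBasis K H i) * μ ((cartanEquivDual H).symm ((Module.finBasis K H).coord i)) =
      μ ((cartanEquivDual H).symm μ) := by
  have h : μ = ∑ i, μ (Module.finBasis K H i) • (Module.finBasis K H).coord i :=
    (Module.finBasis K H).ext fun j ↦ by simp
  conv_rhs => enter [2]; rw [h]
  simp only [map_sum, map_smul, smul_eq_mul]

theorem IsHighestWeightVector.casimir_apply {V : Type*} [AddCommGroup V] [Module K V]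
    [LieRingModule L V] [LieModule K L V] {a : V} (ha : IsHighestWeightVector b μ a)
    (X : DualRootVectors H) : casimir X V a = casimirValue b μ • a := by
  classical
  rw [SymLie.casimir_apply, Fintype.sum_sum_type, casimirValue, LinearMap.add_apply, add_smul,
    add_comm, twoRho, LinearMap.sum_apply, Finset.sum_filter, Finset.sum_smul,
    ← sum_apply_finBasis_mul_apply, Finset.sum_smul]
  simp only [DualRootVectors.fam, DualRootVectors.famDual, Sum.elim_inl, Sum.elim_inr]
  refine congrArg₂ _ (Finset.sum_congr rfl fun i _ ↦ ?_) (Finset.sum_congr rfl fun α _ ↦ ?_)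
  · rw [ha.lie_cartan, lie_smul, ha.lie_cartan, smul_smul, mul_comm]
  · split_ifs with hα
    · rw [leibniz_lie, X.lie_u_v, ha.lie_pos α hα _ (X.u_mem α), lie_zero, add_zero,
        ha.lie_cartan, apply_cartanEquivDual_symm_comm]
      rfl
    · obtain ⟨γ, hγ⟩ := exists_coe_eq_neg α
      have hγpos : b.IsPos γ := isPos_of_root_eq_neg hα (LinearMap.ext (congrFun hγ))
      rw [ha.lie_pos γ hγpos (X.v α) (by rw [hγ]; exact X.v_mem α), lie_zero, zero_smul]

theorem eq_zero_or_exists_pos_apply_cartanEquivDual_symm {ψ χ : Module.Dual K H}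
    (hψ : ∀ i ∈ b.support, ∃ q : ℚ, 0 < q ∧ ψ (coroot i.1) = q) (hχ : χ ∈ simpleRootMonoid b) :
    χ = 0 ∨ ∃ q : ℚ, 0 < q ∧ ψ ((cartanEquivDual H).symm χ) = q := by
  induction hχ using AddSubmonoid.closure_induction with
  | mem χ hχ =>
    obtain ⟨i, hi, rfl⟩ := hχ
    obtain ⟨p, hp, hpi⟩ := exists_pos_root_apply_cartanEquivDual_symm i
    obtain ⟨q, hq, hqi⟩ := hψ i hi
    have h := two_mul_apply_cartanEquivDual_symm ψ i
    rw [hpi, hqi] at h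
    refine Or.inr ⟨p * q / 2, by positivity, ?_⟩
    push_cast
    rw [← h, mul_div_cancel_left₀ _ two_ne_zero]
    rfl
  | zero => exact Or.inl rfl
  | add χ χ' _ _ hχ hχ' =>
    rcases hχ with rfl | ⟨q, hq, hqχ⟩
    · simpa using hχ'
    rcases hχ' with rfl | ⟨r, hr, hrχ⟩
    · simpa using Or.inr ⟨q, hq, hqχ⟩
    · exact Or.inr ⟨q + r, by positivity, by rw [map_add, map_add, hqχ, hrχ, Rat.cast_add]⟩

theorem casimirValue_sub (b : (rootSystem H).Base) (lam μ : Module.Dual K H) :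
    casimirValue b lam - casimirValue b μ =
      (lam + μ + twoRho b) ((cartanEquivDual H).symm (lam - μ)) := by
  simp only [casimirValue, LinearMap.add_apply, map_sub]
  rw [apply_cartanEquivDual_symm_comm lam μ]
  ring

theorem eq_of_casimirValue_eq (hlam : IsDominant b lam) (hμ : IsDominant b μ)
    (hsub : lam - μ ∈ simpleRootMonoid b) (h : casimirValue b lam = casimirValue b μ) :
    lam = μ := by
  have hpos (i) (hi : i ∈ b.support) :
      ∃ q : ℚ, 0 < q ∧ (lam + μ + twoRho b) (coroot i.1) = q := by
    obtain ⟨m, hm⟩ := hlam i hi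
    obtain ⟨n, hn⟩ := hμ i hi
    refine ⟨m + n + 2, by positivity, ?_⟩
    have hrho := toLinearMap_twoRho_coroot hi
    push_cast
    rw [← hm, ← hn, ← hrho]
    rfl
  rcases eq_zero_or_exists_pos_apply_cartanEquivDual_symm hpos hsub with h₀ | ⟨q, hq, hqψ⟩
  · exact sub_eq_zero.1 h₀
  · rw [← casimirValue_sub, h, sub_self] at hqψ
    exact absurd hqψ.symm (by exact_mod_cast hq.ne')

end CasimirEigenvalue

section HighestWeight

open LieAlgebra LieAlgebra.IsKilling LieModule

theorem lieSpan_singleton_mk_eq_top {R L M : Type*} [CommRing R] [LieRing L] [AddCommGroup M]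
    [Module R M] [LieRingModule L M] (v : M) :
    LieSubmodule.lieSpan R L
      {(⟨v, LieSubmodule.subset_lieSpan (Set.mem_singleton v)⟩ :
         LieSubmodule.lieSpan R L {v})} = ⊤ := by
  let W := LieSubmodule.lieSpan R L {v}
  let N := LieSubmodule.lieSpan R L {(⟨v, LieSubmodule.subset_lieSpan (Set.mem_singleton _)⟩ : W)}
  have hle : W ≤ N.map W.incl := LieSubmodule.lieSpan_le.2 (Set.singleton_subset_iff.2
    (LieSubmodule.mem_map_of_mem (f := W.incl) (LieSubmodule.subset_lieSpan (Set.mem_singleton _))))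
  refine eq_top_iff.2 fun w _ ↦ ?_
  obtain ⟨w', hw', h⟩ := (LieSubmodule.mem_map _).1 (hle w.2)
  exact Subtype.ext (a1 := w') (a2 := w) h ▸ hw'

variable {K L : Type*} [Field K] [CharZero K] [LieRing L] [LieAlgebra K L] [FiniteDimensional K L]
  {H : LieSubalgebra K L} [H.IsCartanSubalgebra] [IsKilling K L] [IsTriangularizable K H L]

theorem exists_forall_root_apply_eq_height (b : (rootSystem H).Base) :
    ∃ d : H, ∀ α : H.root, α.1 d = b.height α := by
  let f : Module.Dual K (Module.Dual K H) := b.toWeightBasis.constr K fun _ ↦ (1 : K)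
  have hf (i) (hi : i ∈ b.support) : f ((rootSystem H).root i) = 1 := by
    simpa [f] using b.toWeightBasis.constr_basis K (fun _ ↦ (1 : K)) ⟨i, hi⟩
  refine ⟨(Module.evalEquiv K H).symm f, fun α ↦ ?_⟩
  obtain ⟨g, -, -, hg⟩ := b.exists_root_eq_sum_int α
  calc (rootSystem H).root α ((Module.evalEquiv K H).symm f)
    _ = f ((rootSystem H).root α) := Module.apply_evalEquiv_symm_apply K H _ f
    _ = ∑ i ∈ b.support, (g i : K) := by
      rw [hg, map_sum]
      exact Finset.sum_congr rfl fun i hi ↦ by rw [map_zsmul, hf i hi, zsmul_one]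
    _ = b.height α := by rw [Base.height_eq_sum hg, Int.cast_sum]

theorem exists_forall_lie_eq_smul_of_not_isPos (b : (rootSystem H).Base) :
    ∃ d : H, ∀ α : H.root, ¬ b.IsPos α → ∃ n : ℕ, ∀ z ∈ rootSpace H α.1,
      ⁅(d : L), z⁆ = ((n + 1) * (-1 : K)) • z := by
  obtain ⟨d, hd⟩ := exists_forall_root_apply_eq_height b
  refine ⟨d, fun α hα ↦ ?_⟩
  obtain ⟨n, hn⟩ : ∃ n : ℕ, b.height α = -(n + 1) := by
    have := b.height_ne_zero α
    rw [Base.isPos_iff] at hα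
    exact ⟨(-b.height α - 1).toNat, by lia⟩
  refine ⟨n, fun z hz ↦ ?_⟩
  rw [show ⁅(d : L), z⁆ = α.1 d • z from lie_eq_smul_of_mem_rootSpace hz d, hd, hn]
  push_cast
  ring_nf

variable {V : Type*} [AddCommGroup V] [Module K V] [LieRingModule L V] [LieModule K L V]
  {b : (rootSystem H).Base} {lam μ : Module.Dual K H} {v a : V}

/-- The operators by which the negative root vectors act on a representation. -/
def loweringOperators (b : (rootSystem H).Base) (V : Type*) [AddCommGroup V] [Module K V]
    [LieRingModule L V] [LieModule K L V] : Set (Module.End K V) :=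
  {f | ∃ α : H.root, ¬ b.IsPos α ∧ ∃ z ∈ rootSpace H α.1, f = toEnd K L V z}

theorem exists_forall_loweringOperators_commutator (b : (rootSystem H).Base) (V : Type*)
    [AddCommGroup V] [Module K V] [LieRingModule L V] [LieModule K L V] :
    ∃ d : H, ∀ f ∈ loweringOperators b V, ∃ n : ℕ, ∀ x,
      ⁅(d : L), f x⁆ = f ⁅(d : L), x⁆ + ((n + 1) * (-1 : K)) • f x := by
  obtain ⟨d, hd⟩ := exists_forall_lie_eq_smul_of_not_isPos b
  refine ⟨d, ?_⟩
  rintro _ ⟨α, hα, z, hz, rfl⟩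
  obtain ⟨n, hn⟩ := hd α hα
  exact ⟨n, fun x ↦ by
    rw [toEnd_apply_apply, toEnd_apply_apply, leibniz_lie, hn z hz, smul_lie, add_comm]⟩

theorem lie_mem_weightSpace_add {χ ψ : H → K} {z : L} {x : V} (hz : z ∈ rootSpace H χ)
    (hx : x ∈ weightSpace V ψ) : ⁅z, x⁆ ∈ weightSpace V (χ + ψ) := by
  rw [mem_weightSpace] at hx ⊢
  intro t
  have hz' : ⁅(t : L), z⁆ = χ t • z := lie_eq_smul_of_mem_rootSpace hz t
  have hx' : ⁅(t : L), x⁆ = ψ t • x := hx t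
  change ⁅(t : L), ⁅z, x⁆⁆ = _
  rw [leibniz_lie, hz', hx', smul_lie, lie_smul, ← add_smul, Pi.add_apply]

namespace IsHighestWeightVector

theorem mem_weightSpace (hv : IsHighestWeightVector b lam v) :
    v ∈ weightSpace V (lam : H → K) :=
  (LieModule.mem_weightSpace _ _).2 hv.lie_cartan

theorem lie_mem_closureUnder (hv : IsHighestWeightVector b lam v) (z : L) {x : V}
    (hx : x ∈ closureUnder (Submodule.span K {v}) (loweringOperators b V)) :
    ⁅z, x⁆ ∈ closureUnder (Submodule.span K {v}) (loweringOperators b V) := by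
  have hvmem : v ∈ closureUnder (Submodule.span K {v}) (loweringOperators b V) :=
    le_closureUnder (Submodule.mem_span_singleton_self v)
  refine map_mem_closureUnder_of_commutator (G := Set.range (toEnd K L V)) (g := toEnd K L V z)
    ?_ ?_ (Set.mem_range_self z) hx
  · rintro _ ⟨z, rfl⟩ u hu
    obtain ⟨c, rfl⟩ := Submodule.mem_span_singleton.1 hu
    rw [map_smul]
    refine Submodule.smul_mem _ _ ?_
    induction z using rootSpace_induction (H := H) with
    | zero => simp
    | add y z hy hz =>
      rw [map_add]
      exact add_mem hy hz
    | mem χ z hz =>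
      rw [toEnd_apply_apply]
      rcases eq_zero_or_mem_or_exists_root hz with rfl | ⟨rfl, hzH⟩ | ⟨α, rfl⟩
      · simp
      · rw [hv.lie_cartan ⟨z, hzH⟩]
        exact Submodule.smul_mem _ _ hvmem
      · by_cases hα : b.IsPos α
        · rw [hv.lie_pos α hα z hz]
          exact zero_mem _
        · exact map_mem_closureUnder (T := loweringOperators b V) (f := toEnd K L V z)
            ⟨α, hα, z, hz, rfl⟩ hvmem
  · rintro _ ⟨z, rfl⟩ _ ⟨α, -, y, -, rfl⟩
    exact ⟨_, Set.mem_range_self ⁅z, y⁆, fun x ↦ by simp⟩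

theorem closureUnder_eq_lieSpan (hv : IsHighestWeightVector b lam v) :
    closureUnder (Submodule.span K {v}) (loweringOperators b V) =
      (LieSubmodule.lieSpan K L {v}).toSubmodule := by
  refine le_antisymm (closureUnder_le ?_ ?_) ?_
  · exact Submodule.span_le.2 LieSubmodule.subset_lieSpan
  · rintro _ ⟨α, -, z, -, rfl⟩ x hx
    exact LieSubmodule.lie_mem _ hx
  · let W : LieSubmodule K L V :=
      { closureUnder (Submodule.span K {v}) (loweringOperators b V) with
        lie_mem := fun {z x} hx ↦ hv.lie_mem_closureUnder z hx }
    exact (LieSubmodule.lieSpan_le (N := W)).2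
      (Set.singleton_subset_iff.2 (le_closureUnder (Submodule.mem_span_singleton_self v)))

theorem lieSpan_le_iSup_weightSpace (hv : IsHighestWeightVector b lam v) :
    (LieSubmodule.lieSpan K L {v}).toSubmodule ≤
      ⨆ ν : simpleRootMonoid b, (weightSpace V (lam - ν.1 : H → K)).toSubmodule := by
  rw [← hv.closureUnder_eq_lieSpan]
  refine closureUnder_le ?_ ?_
  · rw [Submodule.span_singleton_le_iff_mem]
    refine Submodule.mem_iSup_of_mem 0 ?_
    rw [LieSubmodule.mem_toSubmodule, LieModule.mem_weightSpace]
    simpa using! hv.lie_cartan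
  · rintro _ ⟨α, hα, z, hz, rfl⟩
    obtain ⟨γ, hγ⟩ := exists_coe_eq_neg α
    have hγpos : b.IsPos γ := isPos_of_root_eq_neg hα (LinearMap.ext (congrFun hγ))
    suffices h : ∀ ν : simpleRootMonoid b, (weightSpace V (lam - ν.1 : H → K)).toSubmodule ≤
        Submodule.comap (toEnd K L V z)
          (⨆ ν : simpleRootMonoid b, (weightSpace V (lam - ν.1 : H → K)).toSubmodule) from
      fun x hx ↦ iSup_le h hx
    intro ν x hx
    refine Submodule.mem_iSup_of_mem
      ⟨ν + (rootSystem H).root γ, add_mem ν.2 (root_mem_simpleRootMonoid hγpos)⟩ ?_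
    have hweight : (lam - (ν.1 + (rootSystem H).root γ : Module.Dual K H) : H → K) =
        α.1 + (lam - ν.1 : H → K) := by
      ext t
      have hγt : γ.1 t = -α.1 t := congrFun hγ t
      simp [hγt]
      ring
    rw [hweight]
    exact lie_mem_weightSpace_add hz hx

theorem sub_mem_simpleRootMonoid (hv : IsHighestWeightVector b lam v)
    (ha : IsHighestWeightVector b μ a) (hav : a ∈ LieSubmodule.lieSpan K L {v}) :
    lam - μ ∈ simpleRootMonoid b := by
  by_contra hc
  have hind := LieSubmodule.iSupIndep_toSubmodule.2 (iSupIndep_genWeightSpace K H V)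
  suffices hle : ⨆ ν : simpleRootMonoid b, (weightSpace V (lam - ν.1 : H → K)).toSubmodule ≤
      ⨆ χ, ⨆ (_ : χ ≠ (μ : H → K)), (genWeightSpace V χ).toSubmodule from
    ha.ne_zero (Submodule.disjoint_def.1 (hind (μ : H → K)) a
      (weightSpace_le_genWeightSpace V _ ha.mem_weightSpace)
      (hle (hv.lieSpan_le_iSup_weightSpace hav)))
  refine iSup_le fun ν ↦ le_trans ?_ (le_iSup₂_of_le (lam - ν.1 : H → K) ?_ le_rfl)
  · exact weightSpace_le_genWeightSpace V _
  · intro h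
    have hν : lam - μ = ν.1 := by
      rw [← DFunLike.coe_injective (F := Module.Dual K H) (a₁ := lam - ν.1) h, sub_sub_cancel]
    rw [hν] at hc
    exact hc ν.2

theorem casimir_apply_of_mem_lieSpan (hv : IsHighestWeightVector b lam v)
    (X : DualRootVectors H) (hav : a ∈ LieSubmodule.lieSpan K L {v}) :
    casimir X V a = casimirValue b lam • a := by
  let N : LieSubmodule K L V :=
    { (casimir X V).eigenspace (casimirValue b lam) with
      lie_mem := fun {z x} hx ↦ Module.End.mem_eigenspace_iff.2 (by
        rw [casimir_lie, Module.End.mem_eigenspace_iff.1 hx, lie_smul]) }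
  exact Module.End.mem_eigenspace_iff.1 ((LieSubmodule.lieSpan_le (N := N)).2
    (Set.singleton_subset_iff.2 (Module.End.mem_eigenspace_iff.2 (hv.casimir_apply X))) hav)

theorem isDominant [FiniteDimensional K V] (ha : IsHighestWeightVector b μ a) :
    IsDominant b μ := by
  intro i hi
  have hi₀ := LieSubalgebra.isNonZero_coe_root i
  obtain ⟨h, e, f, ht, he, hf⟩ := exists_isSl2Triple_of_weight_isNonZero hi₀
  have P : ht.HasPrimitiveVectorWith a (μ (coroot i.1)) :=
    { ne_zero := ha.ne_zero
      lie_h := by rw [ht.h_eq_coroot hi₀ he hf, ha.lie_cartan]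
      lie_e := ha.lie_pos i (Base.isPos_of_mem_support hi) e he }
  exact P.exists_nat

theorem mem_span_singleton [FiniteDimensional K V] (hv : IsHighestWeightVector b lam v)
    (ha : IsHighestWeightVector b μ a) (hav : a ∈ LieSubmodule.lieSpan K L {v}) :
    a ∈ Submodule.span K {v} := by
  obtain ⟨X⟩ : Nonempty (DualRootVectors H) := inferInstance
  have hcasimir : casimirValue b lam = casimirValue b μ := smul_left_injective K ha.ne_zero
    ((hv.casimir_apply_of_mem_lieSpan X hav).symm.trans (ha.casimir_apply X))
  obtain rfl : lam = μ := eq_of_casimirValue_eq hv.isDominant ha.isDominant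
    (hv.sub_mem_simpleRootMonoid ha hav) hcasimir
  obtain ⟨d, hd⟩ := exists_forall_loweringOperators_commutator b V
  have hle : Submodule.span K {v} ≤ (toEnd K L V d).eigenspace (lam d) := by
    rw [Submodule.span_singleton_le_iff_mem, Module.End.mem_eigenspace_iff]
    exact hv.lie_cartan d
  rw [← LieSubmodule.mem_toSubmodule, ← hv.closureUnder_eq_lieSpan] at hav
  exact closureUnder_inf_eigenspace_le hle (neg_ne_zero.2 one_ne_zero) hd
    ⟨hav, Module.End.mem_eigenspace_iff.2 (ha.lie_cartan d)⟩

theorem isTriangularizable (hv : IsHighestWeightVector b lam v)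
    (htop : LieSubmodule.lieSpan K L {v} = ⊤) : IsTriangularizable K H V := by
  refine ⟨fun t ↦ eq_top_iff.2 ?_⟩
  rw [← LieSubmodule.top_toSubmodule (R := K) (L := L), ← htop]
  refine hv.lieSpan_le_iSup_weightSpace.trans (iSup_le fun ν x hx ↦ ?_)
  rw [LieSubmodule.mem_toSubmodule, LieModule.mem_weightSpace] at hx
  exact Submodule.mem_iSup_of_mem _ (Module.End.genEigenspace_le_maximal _ _ 1
    (Module.End.mem_eigenspace_iff.2 (hx t)))

end IsHighestWeightVector

theorem exists_isHighestWeightVector_mem {Y : LieSubmodule K H V} [FiniteDimensional K Y]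
    [IsTriangularizable K H Y] (hY : Y ≠ ⊥)
    (hpos : ∀ α : H.root, b.IsPos α → ∀ z ∈ rootSpace H α.1, ∀ x ∈ Y, ⁅z, x⁆ ∈ Y) :
    ∃ μ, ∃ a ∈ Y, IsHighestWeightVector b μ a := by
  obtain ⟨d, hd⟩ := exists_forall_root_apply_eq_height b
  have : Nontrivial Y := (LieSubmodule.nontrivial_iff_ne_bot K H V).2 hY
  have : Nonempty (Weight K H Y) := by
    by_contra! hempty
    simpa only [iSup_of_empty, bot_ne_top] using iSup_genWeightSpace_eq_top' K H Y
  let r (χ ψ : Weight K H Y) : Prop := ∃ n : ℕ, χ d = ψ d + (n + 1)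
  have hirrefl : Std.Irrefl r := ⟨fun χ ⟨n, hn⟩ ↦ Nat.cast_add_one_ne_zero n (by simpa using hn)⟩
  have htrans : IsTrans (Weight K H Y) r :=
    ⟨fun χ ψ φ ⟨m, hm⟩ ⟨n, hn⟩ ↦ ⟨m + n + 1, by rw [hm, hn]; push_cast; ring⟩⟩
  obtain ⟨χ, -, hχ⟩ := (Finite.wellFounded_of_trans_of_irrefl r).has_min Set.univ
    Set.univ_nonempty
  obtain ⟨⟨a, haY⟩, ha₀, ha⟩ := exists_forall_lie_eq_smul K H Y χ
  have ha₀' : a ≠ 0 := fun h ↦ ha₀ (Subtype.ext h)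
  have haχ : a ∈ weightSpace V (χ : H → K) :=
    (mem_weightSpace _ _).2 fun t ↦ congrArg Subtype.val (ha t)
  refine ⟨χ.toLinear, a, haY, ha₀', (mem_weightSpace _ _).1 haχ, fun α hα z hz ↦ ?_⟩
  by_contra hza
  obtain ⟨n, hn⟩ : ∃ n : ℕ, b.height α = n + 1 := by
    rw [Base.isPos_iff] at hα
    exact ⟨(b.height α - 1).toNat, by lia⟩
  have hw : (⟨⁅z, a⁆, hpos α hα z hz a haY⟩ : Y) ∈ genWeightSpace Y (α.1 + χ : H → K) :=
    weightSpace_le_genWeightSpace Y _ ((mem_weightSpace _ _).2 fun t ↦ Subtype.ext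
      ((mem_weightSpace _ _).1 (lie_mem_weightSpace_add hz haχ) t))
  let ψ : Weight K H Y := ⟨α.1 + χ, fun h ↦ hza (congrArg Subtype.val
    ((LieSubmodule.eq_bot_iff _).1 h _ hw))⟩
  refine hχ ψ trivial ⟨n, ?_⟩
  change α.1 d + χ d = χ d + (n + 1)
  rw [hd, hn, add_comm]
  push_cast
  rfl

theorem IsHighestWeightVector.mem_of_lieSpan_eq_top [FiniteDimensional K V]
    (hv : IsHighestWeightVector b lam v) (htop : LieSubmodule.lieSpan K L {v} = ⊤)
    {Y : LieSubmodule K H V} (hY : Y ≠ ⊥)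
    (hpos : ∀ α : H.root, b.IsPos α → ∀ z ∈ rootSpace H α.1, ∀ x ∈ Y, ⁅z, x⁆ ∈ Y) : v ∈ Y := by
  have := hv.isTriangularizable htop
  obtain ⟨μ, a, haY, ha⟩ := exists_isHighestWeightVector_mem hY hpos
  obtain ⟨c, rfl⟩ := Submodule.mem_span_singleton.1
    (hv.mem_span_singleton ha (by rw [htop]; exact LieSubmodule.mem_top a))
  have hc : c ≠ 0 := fun h ↦ ha.ne_zero (by rw [h, zero_smul])
  exact (Y.toSubmodule.smul_mem_iff hc).1 haY

/-- A nonzero subspace that is stable under the Borel subalgebra contains a highest weight vector,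
and by irreducibility `v` is the only one up to scalars. -/
theorem IsHighestWeightVector.mem_of_ne_bot (hv : IsHighestWeightVector b lam v)
    [FiniteDimensional K (LieSubmodule.lieSpan K L {v})] {Y : Submodule K V}
    (hYv : Y ≤ (LieSubmodule.lieSpan K L {v}).toSubmodule) (hY : Y ≠ ⊥)
    (hH : ∀ t : H, ∀ x ∈ Y, ⁅(t : L), x⁆ ∈ Y)
    (hpos : ∀ α : H.root, b.IsPos α → ∀ z ∈ rootSpace H α.1, ∀ x ∈ Y, ⁅z, x⁆ ∈ Y) : v ∈ Y := by
  let W := LieSubmodule.lieSpan K L {v}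
  let v' : W := ⟨v, LieSubmodule.subset_lieSpan (Set.mem_singleton _)⟩
  have hv' : IsHighestWeightVector b lam v' :=
    ⟨fun h ↦ hv.ne_zero (congrArg Subtype.val h), fun t ↦ Subtype.ext (hv.lie_cartan t),
      fun α hα z hz ↦ Subtype.ext (hv.lie_pos α hα z hz)⟩
  let Y' : LieSubmodule K H W :=
    { Y.comap W.toSubmodule.subtype with lie_mem := fun {t x} hx ↦ hH t x hx }
  have hY' : Y' ≠ ⊥ := by
    obtain ⟨y, hy, hy₀⟩ := Submodule.exists_mem_ne_zero_of_ne_bot hY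
    exact fun h ↦ hy₀ (congrArg Subtype.val ((LieSubmodule.eq_bot_iff _).1 h ⟨y, hYv hy⟩ hy))
  exact hv'.mem_of_lieSpan_eq_top (lieSpan_singleton_mk_eq_top v) hY'
    fun α hα z hz x hx ↦ hpos α hα z hz x hx

theorem IsHighestWeightVector.isIrreducibleWithHighestWeight_lieSpan
    (hv : IsHighestWeightVector b lam v) [FiniteDimensional K (LieSubmodule.lieSpan K L {v})] :
    IsIrreducibleWithHighestWeight b (LieSubmodule.lieSpan K L {v}) lam := by
  let W := LieSubmodule.lieSpan K L {v}
  have hvW : v ∈ W := LieSubmodule.subset_lieSpan (Set.mem_singleton _)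
  have : Nontrivial W := ⟨⟨v, hvW⟩, 0, fun h ↦ hv.ne_zero (congrArg Subtype.val h)⟩
  refine ⟨LieModule.IsIrreducible.mk fun N hN ↦ ?_, v, hvW, hv⟩
  have hmem : v ∈ N.map W.incl := by
    refine hv.mem_of_ne_bot (Y := (N.map W.incl).toSubmodule) LieSubmodule.map_incl_le ?_
      (fun t x hx ↦ LieSubmodule.lie_mem _ hx) fun α _ z _ x hx ↦ LieSubmodule.lie_mem _ hx
    obtain ⟨y, hy, hy₀⟩ := (Submodule.ne_bot_iff N.toSubmodule).1
      (mt (LieSubmodule.toSubmodule_eq_bot N).1 hN)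
    exact (Submodule.ne_bot_iff _).2 ⟨y, ⟨y, hy, rfl⟩, fun h ↦ hy₀ (Subtype.ext h)⟩
  obtain ⟨w, hw, hwv⟩ := (LieSubmodule.mem_map _).1 hmem
  rw [eq_top_iff, ← lieSpan_singleton_mk_eq_top v, LieSubmodule.lieSpan_le]
  obtain rfl : w = ⟨v, hvW⟩ := Subtype.ext hwv
  exact Set.singleton_subset_iff.2 hw

end HighestWeight

section Grading

open LieAlgebra LieAlgebra.IsKilling LieModule

variable {K L : Type*} [Field K] [LieRing L] [LieAlgebra K L] [FiniteDimensional K L]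
  {H : LieSubalgebra K L} [H.IsCartanSubalgebra]

section IsKilling

variable [IsKilling K L]

/-- The sum of the coroots of the roots in `S`, whose adjoint action defines a grading of `L`. -/
noncomputable def corootSum (S : Finset H.root) : H :=
  ∑ β ∈ S, coroot β.1

/-- The piece of degree `m` of the grading of `L` defined by `corootSum S`. -/
noncomputable def gradedPiece (S : Finset H.root) (m : ℤ) : Submodule K L :=
  (ad K L (corootSum S : L)).eigenspace (m : K)

variable {S : Finset H.root} {m n : ℤ} {χ : H → K} {x y : L}

theorem mem_gradedPiece_iff : x ∈ gradedPiece S m ↔ ⁅(corootSum S : L), x⁆ = (m : K) • x :=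
  Module.End.mem_eigenspace_iff

theorem lie_mem_gradedPiece (hx : x ∈ gradedPiece S m) (hy : y ∈ gradedPiece S n) :
    ⁅x, y⁆ ∈ gradedPiece S (m + n) := by
  rw [mem_gradedPiece_iff] at hx hy ⊢
  rw [leibniz_lie, hx, hy, smul_lie, lie_smul, ← add_smul, Int.cast_add]

variable [CharZero K] [IsTriangularizable K H L]

theorem coe_pairingIn (α γ : H.root) :
    ((rootSystem H).pairingIn ℤ α γ : K) = α.1 (coroot γ.1) := by
  rw [intCast_pairingIn, rootSystem_pairing_apply]

theorem root_apply_corootSum (γ : H.root) :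
    γ.1 (corootSum S) = (corootDegree (rootSystem H) S γ : K) := by
  rw [corootSum, corootDegree, Int.cast_sum]
  exact (map_sum γ.1.toLinear _ _).trans (Finset.sum_congr rfl fun β _ ↦ (coe_pairingIn γ β).symm)

theorem mem_gradedPiece_of_mem_rootSpace (hx : x ∈ rootSpace H χ)
    (hχ : χ (corootSum S) = m) : x ∈ gradedPiece S m := by
  rw [mem_gradedPiece_iff, ← hχ]
  exact lie_eq_smul_of_mem_rootSpace hx (corootSum S)

theorem mem_gradedPiece_of_mem_rootSpace_root {γ : H.root} (hx : x ∈ rootSpace H γ.1) :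
    x ∈ gradedPiece S (corootDegree (rootSystem H) S γ) :=
  mem_gradedPiece_of_mem_rootSpace hx (root_apply_corootSum γ)

theorem coe_mem_gradedPiece_zero (t : H) : (t : L) ∈ gradedPiece S 0 := by
  refine mem_gradedPiece_of_mem_rootSpace (χ := 0) ?_ (by simp)
  simp

theorem DualRootVectors.u_mem_gradedPiece (X : DualRootVectors H) (γ : H.root) :
    X.u γ ∈ gradedPiece S (corootDegree (rootSystem H) S γ) :=
  mem_gradedPiece_of_mem_rootSpace_root (X.u_mem γ)

theorem DualRootVectors.v_mem_gradedPiece (X : DualRootVectors H) (γ : H.root) :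
    X.v γ ∈ gradedPiece S (-corootDegree (rootSystem H) S γ) := by
  refine mem_gradedPiece_of_mem_rootSpace (X.v_mem γ) ?_
  rw [Pi.neg_apply, root_apply_corootSum, Int.cast_neg]

theorem gradedPiece_le {N : Submodule K L}
    (hroot : ∀ α : H.root, corootDegree (rootSystem H) S α = m → ∀ x ∈ rootSpace H α.1, x ∈ N)
    (hH : m = 0 → ∀ t : H, (t : L) ∈ N) : gradedPiece S m ≤ N := by
  let D := ad K L (corootSum S : L)
  have hsup (x : L) :
      x ∈ (N ⊓ gradedPiece S m) ⊔ ⨆ μ, ⨆ (_ : μ ≠ (m : K)), D.eigenspace μ := by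
    induction x using rootSpace_induction (H := H) with
    | mem χ x hx =>
      by_cases hχ : χ (corootSum S) = m
      · refine Submodule.mem_sup_left ⟨?_, mem_gradedPiece_of_mem_rootSpace hx hχ⟩
        obtain rfl | ⟨rfl, hxH⟩ | ⟨α, rfl⟩ := eq_zero_or_mem_or_exists_root hx
        · exact zero_mem N
        · exact hH (by simpa using hχ.symm) ⟨x, hxH⟩
        · rw [root_apply_corootSum, Int.cast_inj] at hχ
          exact hroot α hχ x hx
      · refine Submodule.mem_sup_right (Submodule.mem_iSup_of_mem _
          (Submodule.mem_iSup_of_mem hχ ?_))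
        exact Module.End.mem_eigenspace_iff.2 (lie_eq_smul_of_mem_rootSpace hx (corootSum S))
    | zero => exact zero_mem _
    | add x y hx hy => exact add_mem hx hy
  intro x hx
  obtain ⟨y, hy, z, hz, rfl⟩ := Submodule.mem_sup.1 (hsup x)
  have hzm : z ∈ D.eigenspace (m : K) := (Submodule.add_mem_iff_right _ hy.2).1 hx
  rw [Submodule.disjoint_def.1 (D.eigenspaces_iSupIndep m) z hzm hz, add_zero]
  exact hy.1

variable (S) in
theorem iSup_gradedPiece : ⨆ m, gradedPiece S m = ⊤ := by
  have hmem (x : L) : x ∈ ⨆ m, gradedPiece S m := by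
    induction x using rootSpace_induction (H := H) with
    | mem χ x hx =>
      obtain rfl | ⟨-, hxH⟩ | ⟨α, rfl⟩ := eq_zero_or_mem_or_exists_root hx
      · exact zero_mem _
      · exact Submodule.mem_iSup_of_mem 0 (coe_mem_gradedPiece_zero ⟨x, hxH⟩)
      · exact Submodule.mem_iSup_of_mem _ (mem_gradedPiece_of_mem_rootSpace_root hx)
    | zero => exact zero_mem _
    | add x y hx hy => exact add_mem hx hy
  exact eq_top_iff.2 fun x _ ↦ hmem x

theorem IsCascade.gradedPiece_eq_bot (hS : IsCascade (rootSystem H) S) (hm : 2 < |m|) :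
    gradedPiece S m = ⊥ := by
  refine le_bot_iff.1 (gradedPiece_le (fun α hα ↦ ?_) fun h ↦ ?_)
  · have := abs_le.2 ⟨hS.neg_two_le_corootDegree α, hS.corootDegree_le_two α⟩
    lia
  · norm_num [h] at hm

theorem IsCascade.lie_eq_zero (hS : IsCascade (rootSystem H) S) (hx : x ∈ gradedPiece S m)
    (hy : y ∈ gradedPiece S n) (h : 2 < |m + n|) : ⁅x, y⁆ = 0 := by
  have hxy := lie_mem_gradedPiece hx hy
  rwa [hS.gradedPiece_eq_bot h, Submodule.mem_bot] at hxy

theorem IsCascade.gradedPiece_two_le_cons {α : H.root} {hα : α ∉ S}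
    (hS : IsCascade (rootSystem H) (S.cons α hα)) :
    gradedPiece S 2 ≤ gradedPiece (S.cons α hα) 2 := by
  refine gradedPiece_le (fun γ hγ x hx ↦ ?_) (by simp)
  have hdeg : corootDegree (rootSystem H) (S.cons α hα) γ = 2 := by
    rw [corootDegree_cons, hS.pairingIn_eq_zero_of_cons hγ, hγ, zero_add]
  rw [← hdeg]
  exact mem_gradedPiece_of_mem_rootSpace_root hx

namespace DualRootVectors

variable (X : DualRootVectors H)

theorem sum_killingForm_v_smul_u (hm : m ≠ 0) (hx : x ∈ gradedPiece S m) :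
    ∑ γ : {γ // corootDegree (rootSystem H) S γ = m}, killingForm K L (X.v γ) x • X.u γ = x := by
  let f : L →ₗ[K] L := ∑ γ : {γ // corootDegree (rootSystem H) S γ = m},
    (killingForm K L (X.v γ)).smulRight (X.u γ)
  have hle : gradedPiece S m ≤ LinearMap.eqLocus f LinearMap.id := by
    refine gradedPiece_le (fun α hα y hy ↦ ?_) (absurd · hm)
    rw [LinearMap.mem_eqLocus, LinearMap.sum_apply,
      Finset.sum_eq_single ⟨α, hα⟩ (fun γ _ hγ ↦ ?_) (by simp)]
    · exact (X.eq_smul_u hy).symm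
    · have h : (α.1 : H → K) ≠ γ.1.1 := fun h ↦
        hγ (Subtype.ext (Subtype.ext (DFunLike.coe_injective h.symm)))
      rw [LinearMap.smulRight_apply, X.killingForm_v_eq_zero hy h, zero_smul]
  simpa [f, LinearMap.sum_apply] using hle hx

theorem sum_killingForm_u_smul_v (hm : m ≠ 0) (hx : x ∈ gradedPiece S (-m)) :
    ∑ γ : {γ // corootDegree (rootSystem H) S γ = m}, killingForm K L (X.u γ) x • X.v γ = x := by
  let f : L →ₗ[K] L := ∑ γ : {γ // corootDegree (rootSystem H) S γ = m},
    (killingForm K L (X.u γ)).smulRight (X.v γ)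
  have hle : gradedPiece S (-m) ≤ LinearMap.eqLocus f LinearMap.id := by
    refine gradedPiece_le (fun α hα y hy ↦ ?_) fun h ↦ absurd (neg_eq_zero.1 h) hm
    obtain ⟨δ, hδ⟩ := exists_coe_eq_neg α
    have hδm : corootDegree (rootSystem H) S δ = m := by
      have h := root_apply_corootSum (S := S) δ
      rw [hδ, Pi.neg_apply, root_apply_corootSum, hα, ← Int.cast_neg, neg_neg,
        Int.cast_inj] at h
      exact h.symm
    rw [LinearMap.mem_eqLocus, LinearMap.sum_apply,
      Finset.sum_eq_single ⟨δ, hδm⟩ (fun γ _ hγ ↦ ?_) (by simp)]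
    · exact (X.eq_smul_v (neg_eq_iff_eq_neg.2 hδ ▸ hy)).symm
    · have h : (γ.1.1 : H → K) + α.1 ≠ 0 := fun h ↦
        hγ (Subtype.ext (Subtype.ext (DFunLike.coe_injective ((eq_neg_of_add_eq_zero_left h).trans
          hδ.symm))))
      rw [LinearMap.smulRight_apply, killingForm_apply_eq_zero_of_mem_rootSpace_of_add_ne_zero K L H
        (X.u_mem γ) hy h, zero_smul]
  simpa [f, LinearMap.sum_apply] using hle hx

end DualRootVectors

end IsKilling

/-- The adjoint actions of the homogeneous elements of positive degree. -/
def raisingOperators [IsKilling K L] (S : Finset H.root) : Set (Module.End K L) :=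
  {f | ∃ n : ℕ, ∃ z ∈ gradedPiece S (n + 1), f = ad K L z}

variable [CharZero K] [IsTriangularizable K H L] {S : Finset H.root} {m : ℤ} {Y : Submodule K L}

theorem lie_mem_closureUnder_raisingOperators [IsKilling K L] (hYm : Y ≤ gradedPiece S m)
    (hbot : ∀ n < m, gradedPiece S n = ⊥) (hlie : ∀ z ∈ gradedPiece S 0, ∀ y ∈ Y, ⁅z, y⁆ ∈ Y)
    (z : L) {x : L} (hx : x ∈ closureUnder Y (raisingOperators S)) :
    ⁅z, x⁆ ∈ closureUnder Y (raisingOperators S) := by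
  let G : Set (Module.End K L) := {f | ∃ j : ℤ, ∃ z ∈ gradedPiece S j, f = ad K L z}
  have hG {g : Module.End K L} (hg : g ∈ G) : g x ∈ closureUnder Y (raisingOperators S) := by
    refine map_mem_closureUnder_of_commutator ?_ ?_ hg hx
    · rintro _ ⟨j, z, hz, rfl⟩ y hy
      obtain hj | rfl | hj := lt_trichotomy j 0
      · have h := lie_mem_gradedPiece hz (hYm hy)
        rw [hbot _ (by lia), Submodule.mem_bot] at h
        rw [ad_apply, h]
        exact zero_mem _
      · exact le_closureUnder (hlie z hz y hy)
      · obtain ⟨n, rfl⟩ := Int.eq_succ_of_zero_lt hj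
        have hT : ad K L z ∈ raisingOperators S := ⟨n, z, hz, rfl⟩
        exact map_mem_closureUnder hT (le_closureUnder hy)
    · rintro _ ⟨j, z, hz, rfl⟩ _ ⟨n, w, hw, rfl⟩
      exact ⟨ad K L ⁅z, w⁆, ⟨_, _, lie_mem_gradedPiece hz hw, rfl⟩, fun x ↦ by simp⟩
  have hz : z ∈ ⨆ j, gradedPiece S j := iSup_gradedPiece S ▸ Submodule.mem_top
  induction hz using Submodule.iSup_induction' with
  | mem j z hz => exact hG ⟨j, z, hz, rfl⟩
  | zero =>
    rw [zero_lie]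
    exact zero_mem _
  | add z w _ _ hz hw =>
    rw [add_lie]
    exact add_mem hz hw

theorem gradedPiece_le_of_lie_mem [LieAlgebra.IsSimple K L] (hY : Y ≠ ⊥)
    (hYm : Y ≤ gradedPiece S m) (hbot : ∀ n < m, gradedPiece S n = ⊥)
    (hlie : ∀ z ∈ gradedPiece S 0, ∀ y ∈ Y, ⁅z, y⁆ ∈ Y) : gradedPiece S m ≤ Y := by
  let I : LieIdeal K L :=
    { closureUnder Y (raisingOperators S) with
      lie_mem := lie_mem_closureUnder_raisingOperators hYm hbot hlie _ }
  have hI : I ≠ ⊥ := fun h ↦ hY (eq_bot_iff.2 fun y hy ↦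
    (LieSubmodule.mem_bot y).1 (h.le (show y ∈ I from le_closureUnder hy)))
  replace hI : I = ⊤ := (LieAlgebra.IsSimple.eq_bot_or_eq_top I).resolve_left hI
  intro x hx
  refine closureUnder_inf_eigenspace_le (D := ad K L (corootSum S : L)) (e := 1) hYm one_ne_zero ?_
    ⟨hI.ge (LieSubmodule.mem_top x), hx⟩
  rintro _ ⟨n, z, hz, rfl⟩
  refine ⟨n, fun x ↦ ?_⟩
  rw [mem_gradedPiece_iff] at hz
  rw [ad_apply, ad_apply, ad_apply, ad_apply, leibniz_lie, hz, smul_lie, add_comm]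
  push_cast
  rw [mul_one]

end Grading

section SymmetricPower

open SymmetricAlgebra

variable {R L M : Type*} [CommRing R] [LieRing L] [LieAlgebra R L] [AddCommGroup M] [Module R M]
  [LieRingModule L M] [LieModule R L M]

theorem lie_algebraMap (x : L) (r : R) : ⁅x, algebraMap R (SymmetricAlgebra R M) r⁆ = 0 :=
  (symHom R L M x).map_algebraMap r

instance [Module.Finite R M] (n : ℕ) : Module.Finite R (symPow R L M n) :=
  Module.Finite.iff_fg.2 (Submodule.FG.pow (Module.Finite.iff_fg.1 (Module.Finite.range (ι R M))) n)

variable {A B : Submodule R M} {n : ℕ} {a : SymmetricAlgebra R M} {x : L}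

variable (L) in
theorem mem_symPow_of_mem_map_ι_pow (ha : a ∈ A.map (ι R M) ^ n) : a ∈ symPow R L M n :=
  pow_le_pow_left' (LinearMap.map_le_range) n ha

theorem lie_mem_map_ι_pow (hx : ∀ y ∈ A, ⁅x, y⁆ ∈ A) (ha : a ∈ A.map (ι R M) ^ n) :
    ⁅x, a⁆ ∈ A.map (ι R M) ^ n := by
  induction ha using Submodule.pow_induction_on_left' with
  | algebraMap r =>
    rw [lie_algebraMap]
    exact zero_mem _
  | add a b i _ _ ha hb =>
    rw [lie_add]
    exact add_mem ha hb
  | mem_mul m hm i a ha ih =>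
    obtain ⟨y, hy, rfl⟩ := hm
    rw [lie_mul, lie_ι, pow_succ']
    exact add_mem (Submodule.mul_mem_mul (Submodule.mem_map_of_mem (hx y hy)) ha)
      (Submodule.mul_mem_mul (Submodule.mem_map_of_mem hy) ih)

theorem lie_eq_zero_of_mem_map_ι_pow (hx : ∀ y ∈ A, ⁅x, y⁆ = 0) (ha : a ∈ A.map (ι R M) ^ n) :
    ⁅x, a⁆ = 0 := by
  induction ha using Submodule.pow_induction_on_left' with
  | algebraMap r => exact lie_algebraMap x r
  | add a b i _ _ ha hb => rw [lie_add, ha, hb, add_zero]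
  | mem_mul m hm _ a _ ih =>
    obtain ⟨y, hy, rfl⟩ := hm
    rw [lie_mul, lie_ι, hx y hy, map_zero, zero_mul, ih, mul_zero, add_zero]

theorem algHom_eq_of_mem_map_ι_pow {C : Type*} [CommSemiring C] [Algebra R C]
    {f g : SymmetricAlgebra R M →ₐ[R] C} (hfg : ∀ y ∈ A, f (ι R M y) = g (ι R M y))
    (ha : a ∈ A.map (ι R M) ^ n) : f a = g a := by
  induction ha using Submodule.pow_induction_on_left' with
  | algebraMap r => rw [AlgHom.commutes, AlgHom.commutes]
  | add a b i _ _ ha hb => rw [map_add, map_add, ha, hb]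
  | mem_mul m hm _ a _ ih =>
    obtain ⟨y, hy, rfl⟩ := hm
    rw [map_mul, map_mul, ih, hfg y hy]

end SymmetricPower

section Evaluation

open LieAlgebra LieAlgebra.IsKilling LieModule

variable {K L : Type*} [Field K] [LieRing L] [LieAlgebra K L]

/-- Evaluation at `E` of elements of the symmetric algebra of `L`, viewed as polynomial functions on
`L` through the Killing form. -/
noncomputable def evalAt (E : L) : SymmetricAlgebra K L →ₐ[K] K :=
  SymmetricAlgebra.lift (killingForm K L E)

@[simp]
theorem evalAt_ι (E x : L) : evalAt E (SymmetricAlgebra.ι K L x) = killingForm K L E x :=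
  SymmetricAlgebra.lift_ι_apply _ _

theorem evalAt_lie {z E : L} (h : ⁅z, E⁆ = 0) (a : SymmetricAlgebra K L) :
    evalAt E ⁅z, a⁆ = 0 := by
  induction a using SymmetricAlgebra.induction with
  | algebraMap r => rw [lie_algebraMap, map_zero]
  | ι x =>
    rw [lie_ι, evalAt_ι, ← neg_eq_zero, ← traceForm_apply_lie_apply', h, map_zero,
      LinearMap.zero_apply]
  | mul a b ha hb => rw [lie_mul, map_add, map_mul, map_mul, ha, hb, zero_mul, mul_zero, add_zero]
  | add a b ha hb => rw [lie_add, map_add, ha, hb, add_zero]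

end Evaluation

theorem exists_linearMap_of_graph {K V W : Type*} [Field K] [AddCommGroup V] [Module K V]
    [AddCommGroup W] [Module K W] {N : Submodule K (V × W)} (hN : ∀ w, (0, w) ∈ N → w = 0) :
    ∃ φ : V →ₗ[K] W, ∀ p ∈ N, φ p.1 = p.2 := by
  obtain ⟨g, hg⟩ := (LinearMap.fst K V W ∘ₗ N.subtype).exists_leftInverse_of_injective <|
    LinearMap.ker_eq_bot'.2 fun p hp ↦ by
      obtain ⟨⟨v, w⟩, hvw⟩ := p
      obtain rfl : v = 0 := hp
      rw [Submodule.mk_eq_zero, Prod.mk_eq_zero]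
      exact ⟨rfl, hN w hvw⟩
  refine ⟨LinearMap.snd K V W ∘ₗ N.subtype ∘ₗ g, fun p hp ↦ ?_⟩
  exact congrArg (fun q : N ↦ q.1.2) (LinearMap.congr_fun hg ⟨p, hp⟩)

section TwistedEquivariance

open LieAlgebra LieAlgebra.IsKilling LieModule

variable {K L : Type*} [Field K] [LieRing L] [LieAlgebra K L]
  {V : Type*} [AddCommGroup V] [Module K V] [LieRingModule L V] [LieModule K L V]

/-- The action of `L` on pairs, twisted on the second component by the linear form `ω`. -/
def pairAction (V : Type*) [AddCommGroup V] [Module K V] [LieRingModule L V] [LieModule K L V]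
    (ω : Module.Dual K L) : L →ₗ[K] Module.End K (L × V) where
  toFun z := (ad K L z).prodMap (toEnd K L V z - ω z • LinearMap.id)
  map_add' y z := by
    ext <;> simp [add_smul]
    abel
  map_smul' c z := by ext <;> simp [smul_sub, mul_smul]

theorem pairAction_apply (ω : Module.Dual K L) (z : L) (p : L × V) :
    pairAction V ω z p = (⁅z, p.1⁆, ⁅z, p.2⁆ - ω z • p.2) :=
  rfl

theorem pairAction_pairAction {ω : Module.Dual K L} {y z : L} (h : ω ⁅y, z⁆ = 0) (p : L × V) :
    pairAction V ω y (pairAction V ω z p) =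
      pairAction V ω z (pairAction V ω y p) + pairAction V ω ⁅y, z⁆ p := by
  simp only [pairAction_apply, h, lie_sub, lie_smul, lie_lie, zero_smul, Prod.mk_add_mk, smul_sub]
  ext
  · simp
  · simp only [smul_comm (ω y)]
    abel

variable [FiniteDimensional K L] {H : LieSubalgebra K L} [H.IsCartanSubalgebra] [IsKilling K L]
  {S : Finset H.root}

/-- The vectors annihilated by all homogeneous elements of positive degree. -/
noncomputable def positiveInvariants (S : Finset H.root) (V : Type*) [AddCommGroup V] [Module K V]
    [LieRingModule L V] [LieModule K L V] : Submodule K V :=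
  ⨅ m : ℤ, ⨅ _ : 0 < m, ⨅ z ∈ gradedPiece S m, LinearMap.ker (toEnd K L V z)

theorem mem_positiveInvariants {v : V} :
    v ∈ positiveInvariants S V ↔ ∀ m > 0, ∀ z ∈ gradedPiece S m, ⁅z, v⁆ = 0 := by
  simp only [positiveInvariants, Submodule.mem_iInf, LinearMap.mem_ker, toEnd_apply_apply,
    gt_iff_lt]

theorem lie_mem_positiveInvariants {z : L} {v : V} (hz : z ∈ gradedPiece S 0)
    (hv : v ∈ positiveInvariants S V) : ⁅z, v⁆ ∈ positiveInvariants S V := by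
  rw [mem_positiveInvariants] at hv ⊢
  intro m hm y hy
  have hyz := lie_mem_gradedPiece hy hz
  rw [add_zero] at hyz
  rw [leibniz_lie, hv m hm y hy, hv m hm _ hyz, lie_zero, add_zero]

variable [CharZero K] [IsTriangularizable K H L] {b : (rootSystem H).Base}

/-- The sum of the roots in `S`. -/
noncomputable def rootSum (S : Finset H.root) : Module.Dual K H :=
  ∑ β ∈ S, (rootSystem H).root β

/-- The linear form on `L` that extends `rootSum S` by zero on the root spaces. -/
noncomputable def twist (S : Finset H.root) : Module.Dual K L :=
  killingForm K L ((cartanEquivDual H).symm (rootSum S) : H)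

theorem twist_coe (t : H) : twist S (t : L) = rootSum S t :=
  killingForm_cartanEquivDual_symm _ _

theorem twist_eq_zero {χ : H → K} {x : L} (hx : x ∈ rootSpace H χ) (hχ : χ ≠ 0) :
    twist S x = 0 :=
  killingForm_apply_eq_zero_of_mem_rootSpace_of_add_ne_zero K L H (α := 0) (by simp) hx
    (by simpa using hχ)

theorem twist_root_eq_zero {γ : H.root} {x : L} (hx : x ∈ rootSpace H γ.1) : twist S x = 0 :=
  twist_eq_zero hx (LieSubalgebra.isNonZero_coe_root γ)

theorem IsLongOrthogonal.rootSum_apply_cartanEquivDual_symm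
    (hS : IsLongOrthogonal (rootSystem H) S) {γ : H.root}
    (hγ : corootDegree (rootSystem H) S γ = 0) :
    rootSum S ((cartanEquivDual H).symm γ.1.toLinear) = 0 := by
  have hsum : rootSum S (coroot γ.1) = 0 := by
    have h : rootSum S (coroot γ.1) =
        ((∑ β ∈ S, (rootSystem H).pairingIn ℤ β γ : ℤ) : K) := by
      rw [rootSum, LinearMap.sum_apply, Int.cast_sum]
      exact Finset.sum_congr rfl fun β _ ↦ (coe_pairingIn β γ).symm
    rw [h, hS.sum_pairingIn_eq_zero hγ, Int.cast_zero]
  have h := two_mul_apply_cartanEquivDual_symm (rootSum S) γ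
  rw [hsum, mul_zero] at h
  exact (mul_eq_zero.1 h).resolve_left two_ne_zero

theorem IsLongOrthogonal.twist_lie (hS : IsLongOrthogonal (rootSystem H) S) {z : L}
    (hz : z ∈ gradedPiece S 0) (x : L) : twist S ⁅z, x⁆ = 0 := by
  let t : H := (cartanEquivDual H).symm (rootSum S)
  have hcomm : gradedPiece S 0 ≤ LinearMap.ker (ad K L (t : L)) := by
    refine gradedPiece_le (fun γ hγ y hy ↦ ?_) fun _ s ↦ ?_
    · have h : γ.1 t = 0 := by
        rw [← hS.rootSum_apply_cartanEquivDual_symm hγ]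
        exact apply_cartanEquivDual_symm_comm γ.1.toLinear (rootSum S)
      exact (lie_eq_smul_of_mem_rootSpace hy t).trans (by rw [h, zero_smul])
    · exact congrArg Subtype.val (trivial_lie_zero H H t s)
  have h : ⁅(t : L), z⁆ = 0 := hcomm hz
  calc twist S ⁅z, x⁆ = killingForm K L ⁅(t : L), z⁆ x :=
        (traceForm_apply_lie_apply K L L _ _ _).symm
    _ = 0 := by rw [h, map_zero, LinearMap.zero_apply]

/-- Cascades on whose coroot sum all positive roots are nonnegative. -/
structure IsDominantCascade (b : (rootSystem H).Base) (S : Finset H.root) : Prop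
    extends IsCascade (rootSystem H) S where
  corootDegree_nonneg : ∀ γ, b.IsPos γ → 0 ≤ corootDegree (rootSystem H) S γ

theorem IsDominantCascade.isPos (hS : IsDominantCascade b S) {γ : H.root}
    (hγ : 0 < corootDegree (rootSystem H) S γ) : b.IsPos γ := by
  by_contra h
  have hneg : (rootSystem H).root ((rootSystem H).reflectionPerm γ γ) = -(rootSystem H).root γ := by
    rw [root_reflectionPerm, reflection_apply_self]
  have := hS.corootDegree_nonneg _ (isPos_of_root_eq_neg h hneg)
  rw [corootDegree_neg hneg] at this
  lia

theorem IsDominantCascade.mem_positiveInvariants (hS : IsDominantCascade b S)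
    {μ : Module.Dual K H} {v : V} (hv : IsHighestWeightVector b μ v) :
    v ∈ positiveInvariants S V := by
  refine SymLie.mem_positiveInvariants.2 fun m hm z hz ↦ ?_
  have hle : gradedPiece S m ≤ LinearMap.ker ((toEnd K L V : L →ₗ[K] Module.End K V).flip v) :=
    gradedPiece_le (fun γ hγ x hx ↦ hv.lie_pos γ (hS.isPos (hγ ▸ hm)) x hx) fun h ↦
      absurd h hm.ne'
  exact hle hz

/-- The twisted actions on pairs of the negative root vectors of degree zero. -/
def loweringPairActions (b : (rootSystem H).Base) (S : Finset H.root) (V : Type*)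
    [AddCommGroup V] [Module K V] [LieRingModule L V] [LieModule K L V] :
    Set (Module.End K (L × V)) :=
  {f | ∃ γ : H.root, ¬ b.IsPos γ ∧ corootDegree (rootSystem H) S γ = 0 ∧
    ∃ z ∈ rootSpace H γ.1, f = pairAction V (twist S) z}

/-- The smallest subspace of `L × V` that contains `p` and is stable under `loweringPairActions`. -/
noncomputable def pairSpan (b : (rootSystem H).Base) (S : Finset H.root) (p : L × V) :
    Submodule K (L × V) :=
  closureUnder (K ∙ p) (loweringPairActions b S V)

theorem DualRootVectors.lie_v_eq_zero (X : DualRootVectors H) {α γ : H.root} {x : L}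
    (hx : x ∈ rootSpace H γ.1) (hne : γ ≠ α)
    (h : (rootSystem H).root α - (rootSystem H).root γ ∉ Set.range (rootSystem H).root) :
    ⁅x, X.v α⁆ = 0 := by
  have hmem := lie_mem_genWeightSpace_of_mem_genWeightSpace hx (X.v_mem α)
  obtain h₀ | ⟨h₀, -⟩ | ⟨δ, hδ⟩ := eq_zero_or_mem_or_exists_root hmem
  · exact h₀
  · exact absurd (Subtype.ext (DFunLike.coe_injective (add_neg_eq_zero.1 h₀))) hne
  · obtain ⟨δ', hδ'⟩ := exists_coe_eq_neg δ
    refine absurd ⟨δ', LinearMap.ext fun t ↦ ?_⟩ h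
    have := congrFun (hδ'.trans (congrArg Neg.neg hδ.symm)) t
    simpa [sub_eq_add_neg, add_comm] using this

section Step

variable {α : H.root} {hα : α ∉ S} {F : V}

theorem pairAction_coe_mk_v (X : DualRootVectors H) (hF : IsHighestWeightVector b (rootSum S) F)
    (t : H) (c : K) :
    pairAction V (twist (S.cons α hα)) (t : L) (c • X.v α, F) =
      -α.1 t • (c • X.v α, F) := by
  have hv : ⁅(t : L), X.v α⁆ = -α.1 t • X.v α := lie_eq_smul_of_mem_rootSpace (X.v_mem α) t
  have hsum : rootSum (S.cons α hα) t = α.1 t + rootSum S t := by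
    rw [rootSum, Finset.sum_cons, ← rootSum, LinearMap.add_apply]
    rfl
  rw [pairAction_apply, lie_smul, hv, hF.lie_cartan, twist_coe, hsum, Prod.smul_mk, ← sub_smul,
    smul_comm c]
  congr 2
  ring

theorem pairAction_mk_v_mem_pairSpan (X : DualRootVectors H)
    (hS : ∀ γ, b.IsPos γ → 0 ≤ corootDegree (rootSystem H) S γ)
    (hS' : IsLongOrthogonal (rootSystem H) (S.cons α hα))
    (hF : IsHighestWeightVector b (rootSum S) F) {z : L}
    (hz : z ∈ gradedPiece (S.cons α hα) 0) :
    pairAction V (twist (S.cons α hα)) z (X.v α, F) ∈ pairSpan b (S.cons α hα) (X.v α, F) := by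
  have hmem : (X.v α, F) ∈ pairSpan b (S.cons α hα) (X.v α, F) :=
    le_closureUnder (Submodule.mem_span_singleton_self _)
  have hle : gradedPiece (S.cons α hα) 0 ≤ (pairSpan b (S.cons α hα) (X.v α, F)).comap
      ((pairAction V (twist (S.cons α hα))).flip (X.v α, F)) := by
    refine gradedPiece_le (fun γ hγ x hx ↦ ?_) fun _ t ↦ ?_
    · rw [Submodule.mem_comap, LinearMap.flip_apply]
      by_cases hpos : b.IsPos γ
      · have hαS : α ∈ S.cons α hα := Finset.mem_cons_self α S
        have hne : γ ≠ α := by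
          rintro rfl
          exact two_ne_zero ((hS'.corootDegree_eq_two hαS).symm.trans hγ)
        have hpair : (rootSystem H).pairingIn ℤ γ α ≤ 0 := by
          have := hS γ hpos
          rw [corootDegree_cons] at hγ
          lia
        rw [pairAction_apply, hF.lie_pos γ hpos x hx, twist_root_eq_zero hx, zero_smul, sub_zero,
          X.lie_v_eq_zero hx hne ((hS'.long α hαS).root_sub_root_notMem hpair)]
        exact zero_mem _
      · have hT : pairAction V (twist (S.cons α hα)) x ∈ loweringPairActions b (S.cons α hα) V :=
          ⟨γ, hpos, hγ, x, hx, rfl⟩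
        exact map_mem_closureUnder hT hmem
    · rw [Submodule.mem_comap, LinearMap.flip_apply]
      have h := pairAction_coe_mk_v (hα := hα) X hF t 1
      rw [one_smul] at h
      rw [h]
      exact Submodule.smul_mem _ _ hmem
  exact hle hz

theorem pairAction_mem_pairSpan (X : DualRootVectors H)
    (hS : ∀ γ, b.IsPos γ → 0 ≤ corootDegree (rootSystem H) S γ)
    (hS' : IsLongOrthogonal (rootSystem H) (S.cons α hα))
    (hF : IsHighestWeightVector b (rootSum S) F) {z : L}
    (hz : z ∈ gradedPiece (S.cons α hα) 0) {p : L × V}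
    (hp : p ∈ pairSpan b (S.cons α hα) (X.v α, F)) :
    pairAction V (twist (S.cons α hα)) z p ∈ pairSpan b (S.cons α hα) (X.v α, F) := by
  let G : Set (Module.End K (L × V)) :=
    {f | ∃ y ∈ gradedPiece (S.cons α hα) 0, f = pairAction V (twist (S.cons α hα)) y}
  refine map_mem_closureUnder_of_commutator (G := G) ?_ ?_ ⟨z, hz, rfl⟩ hp
  · rintro _ ⟨y, hy, rfl⟩ u hu
    obtain ⟨c, rfl⟩ := Submodule.mem_span_singleton.1 hu
    rw [map_smul]
    exact Submodule.smul_mem _ _ (pairAction_mk_v_mem_pairSpan X hS hS' hF hy)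
  · rintro _ ⟨y, hy, rfl⟩ _ ⟨γ, -, hγ, w, hw, rfl⟩
    have hw₀ : w ∈ gradedPiece (S.cons α hα) 0 := hγ ▸ mem_gradedPiece_of_mem_rootSpace_root hw
    exact ⟨_, ⟨⁅y, w⁆, by simpa using lie_mem_gradedPiece hy hw₀, rfl⟩,
      pairAction_pairAction (hS'.twist_lie hy w)⟩

theorem pairSpan_le (X : DualRootVectors H) (hS' : IsDominantCascade b (S.cons α hα))
    (hF : IsHighestWeightVector b (rootSum S) F) :
    pairSpan b (S.cons α hα) (X.v α, F) ≤ (gradedPiece (S.cons α hα) (-2)).prod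
      ((LieSubmodule.lieSpan K L {F}).toSubmodule ⊓ positiveInvariants (S.cons α hα) V) := by
  refine closureUnder_le ?_ ?_
  · rw [Submodule.span_singleton_le_iff_mem, Submodule.mem_prod]
    refine ⟨?_, LieSubmodule.subset_lieSpan (Set.mem_singleton F),
      hS'.mem_positiveInvariants hF⟩
    rw [← hS'.corootDegree_eq_two (Finset.mem_cons_self α S)]
    exact X.v_mem_gradedPiece α
  · rintro _ ⟨γ, -, hγ, z, hz, rfl⟩ p ⟨hp₁, hp₂, hp₃⟩
    have hz₀ : z ∈ gradedPiece (S.cons α hα) 0 := hγ ▸ mem_gradedPiece_of_mem_rootSpace_root hz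
    rw [pairAction_apply, twist_root_eq_zero hz, zero_smul, sub_zero]
    refine ⟨?_, LieSubmodule.lie_mem _ hp₂, lie_mem_positiveInvariants hz₀ hp₃⟩
    simpa using lie_mem_gradedPiece hz₀ hp₁

theorem mk_zero_notMem_pairSpan (X : DualRootVectors H)
    (hS' : IsLongOrthogonal (rootSystem H) (S.cons α hα))
    (hF : IsHighestWeightVector b (rootSum S) F) :
    (0, F) ∉ pairSpan b (S.cons α hα) (X.v α, F) := by
  intro hmem
  obtain ⟨d, hd⟩ := exists_forall_lie_eq_smul_of_not_isPos b
  let D := pairAction V (twist (S.cons α hα)) (d : L)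
  have hD (c : K) : (c • X.v α, F) ∈ D.eigenspace (-α.1 d) :=
    Module.End.mem_eigenspace_iff.2 (pairAction_coe_mk_v X hF d c)
  have hle : pairSpan b (S.cons α hα) (X.v α, F) ⊓ D.eigenspace (-α.1 d) ≤ K ∙ (X.v α, F) := by
    refine closureUnder_inf_eigenspace_le (e := -1) ?_ (neg_ne_zero.2 one_ne_zero) ?_
    · rw [Submodule.span_singleton_le_iff_mem]
      simpa using hD 1
    · rintro _ ⟨γ, hγ, -, z, hz, rfl⟩
      obtain ⟨n, hn⟩ := hd γ hγ
      refine ⟨n, fun p ↦ ?_⟩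
      rw [pairAction_pairAction (hS'.twist_lie (coe_mem_gradedPiece_zero d) z), hn z hz, map_smul]
      rfl
  obtain ⟨c, hc⟩ := Submodule.mem_span_singleton.1 (hle ⟨hmem, by simpa using hD 0⟩)
  rw [Prod.smul_mk, Prod.mk.injEq, smul_eq_zero] at hc
  obtain rfl := hc.1.resolve_right (X.v_ne_zero α)
  exact hF.ne_zero (by rw [← hc.2, zero_smul])

theorem eq_zero_of_mk_zero_mem_pairSpan (X : DualRootVectors H)
    [FiniteDimensional K (LieSubmodule.lieSpan K L {F})]
    (hS : ∀ γ, b.IsPos γ → 0 ≤ corootDegree (rootSystem H) S γ)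
    (hS' : IsDominantCascade b (S.cons α hα))
    (hF : IsHighestWeightVector b (rootSum S) F) {w : V}
    (hw : (0, w) ∈ pairSpan b (S.cons α hα) (X.v α, F)) : w = 0 := by
  let Y : Submodule K V :=
    (pairSpan b (S.cons α hα) (X.v α, F)).comap (LinearMap.inr K L V)
  have hle : Y ≤ (LieSubmodule.lieSpan K L {F}).toSubmodule ⊓
      positiveInvariants (S.cons α hα) V := fun x hx ↦ (pairSpan_le X hS' hF hx).2
  have hlie {z : L} (hz : z ∈ gradedPiece (S.cons α hα) 0) {x : V} (hx : x ∈ Y) : ⁅z, x⁆ ∈ Y := by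
    have h := pairAction_mem_pairSpan X hS hS'.toIsLongOrthogonal hF hz hx
    have hmem : ⁅z, x⁆ - twist (S.cons α hα) z • x ∈ Y := by
      simpa [pairAction_apply, Y] using h
    simpa using add_mem hmem (Submodule.smul_mem Y (twist (S.cons α hα) z) hx)
  suffices hY : Y = ⊥ from (Submodule.mem_bot K).1 (hY ▸ hw)
  by_contra hY
  refine mk_zero_notMem_pairSpan X hS'.toIsLongOrthogonal hF (hF.mem_of_ne_bot (Y := Y)
    (hle.trans inf_le_left) hY (fun t x hx ↦ hlie (coe_mem_gradedPiece_zero t) hx)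
    fun γ hγ z hz x hx ↦ ?_)
  have hzγ := mem_gradedPiece_of_mem_rootSpace_root (S := S.cons α hα) hz
  obtain h₀ | hpos := (hS'.corootDegree_nonneg γ hγ).eq_or_lt
  · exact hlie (h₀ ▸ hzγ) hx
  · rw [mem_positiveInvariants.1 (hle hx).2 _ hpos z hzγ]
    exact zero_mem Y

end Step

end TwistedEquivariance

section TwistedEquivariantMap

open LieAlgebra LieAlgebra.IsKilling LieModule

variable {K L : Type*} [Field K] [CharZero K] [LieRing L] [LieAlgebra K L] [FiniteDimensional K L]
  {H : LieSubalgebra K L} [H.IsCartanSubalgebra] [IsTriangularizable K H L]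
  {V : Type*} [AddCommGroup V] [Module K V] [LieRingModule L V]

/-- Linear maps that, on the piece of degree `-2`, intertwine the action of the elements of degree
zero with their action on `V` twisted by `-twist S`. -/
def IsTwistedEquivariant [IsKilling K L] (S : Finset H.root) (φ : L →ₗ[K] V) : Prop :=
  ∀ z ∈ gradedPiece S 0, ∀ y ∈ gradedPiece S (-2), φ ⁅z, y⁆ = ⁅z, φ y⁆ - twist S z • φ y

variable [LieAlgebra.IsSimple K L] {S : Finset H.root}

theorem IsCascade.gradedPiece_neg_two_le (hS : IsCascade (rootSystem H) S) {Y : Submodule K L}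
    (hY : Y ≤ gradedPiece S (-2)) (hlie : ∀ z ∈ gradedPiece S 0, ∀ y ∈ Y, ⁅z, y⁆ ∈ Y)
    {y : L} (hy : y ∈ Y) (hy₀ : y ≠ 0) : gradedPiece S (-2) ≤ Y := by
  refine gradedPiece_le_of_lie_mem (fun h ↦ hy₀ ((Submodule.mem_bot K).1 (h ▸ hy))) hY
    (fun n hn ↦ hS.gradedPiece_eq_bot ?_) hlie
  rw [abs_of_neg (by lia)]
  lia

theorem IsTwistedEquivariant.map_mem {φ : L →ₗ[K] V} (hφ : IsTwistedEquivariant S φ)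
    (hS : IsCascade (rootSystem H) S) {A : Submodule K V}
    (hA : ∀ z ∈ gradedPiece S 0, ∀ a ∈ A, ⁅z, a⁆ ∈ A) {y : L} (hy : y ∈ gradedPiece S (-2))
    (hy₀ : y ≠ 0) (hyA : φ y ∈ A) {x : L} (hx : x ∈ gradedPiece S (-2)) : φ x ∈ A := by
  have hle : gradedPiece S (-2) ≤ gradedPiece S (-2) ⊓ A.comap φ := by
    refine hS.gradedPiece_neg_two_le inf_le_left (fun z hz w hw ↦ ⟨?_, ?_⟩) ⟨hy, hyA⟩ hy₀
    · simpa using lie_mem_gradedPiece hz hw.1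
    · change φ ⁅z, w⁆ ∈ A
      rw [hφ z hz w hw.1]
      exact sub_mem (hA z hz _ hw.2) (A.smul_mem _ hw.2)
  exact (hle hx).2

variable [LieModule K L V] {b : (rootSystem H).Base} {α : H.root} {hα : α ∉ S} {F : V}

theorem exists_isTwistedEquivariant (X : DualRootVectors H)
    [FiniteDimensional K (LieSubmodule.lieSpan K L {F})]
    (hS : ∀ γ, b.IsPos γ → 0 ≤ corootDegree (rootSystem H) S γ)
    (hS' : IsDominantCascade b (S.cons α hα)) (hF : IsHighestWeightVector b (rootSum S) F) :
    ∃ φ : L →ₗ[K] V, φ (X.v α) = F ∧ IsTwistedEquivariant (S.cons α hα) φ := by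
  obtain ⟨φ, hφ⟩ := exists_linearMap_of_graph fun w ↦
    eq_zero_of_mk_zero_mem_pairSpan (w := w) X hS hS' hF
  have hmem : (X.v α, F) ∈ pairSpan b (S.cons α hα) (X.v α, F) :=
    le_closureUnder (Submodule.mem_span_singleton_self _)
  have hle : gradedPiece (S.cons α hα) (-2) ≤
      (pairSpan b (S.cons α hα) (X.v α, F)).map (LinearMap.fst K L V) := by
    refine hS'.gradedPiece_neg_two_le ?_ ?_ (Submodule.mem_map_of_mem hmem) (X.v_ne_zero α)
    · rintro _ ⟨p, hp, rfl⟩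
      exact (pairSpan_le X hS' hF hp).1
    · rintro z hz _ ⟨p, hp, rfl⟩
      exact ⟨_, pairAction_mem_pairSpan X hS hS'.toIsLongOrthogonal hF hz hp, rfl⟩
  refine ⟨φ, hφ _ hmem, fun z hz y hy ↦ ?_⟩
  obtain ⟨p, hp, rfl⟩ := hle hy
  have h := hφ _ (pairAction_mem_pairSpan X hS hS'.toIsLongOrthogonal hF hz hp)
  rwa [pairAction_apply, ← hφ p hp] at h

end TwistedEquivariantMap

section Contraction

open LieAlgebra LieAlgebra.IsKilling LieModule SymmetricAlgebra

variable {K L : Type*} [Field K] [CharZero K] [LieRing L] [LieAlgebra K L] [FiniteDimensional K L]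
  [IsKilling K L] {H : LieSubalgebra K L} [H.IsCartanSubalgebra] [IsTriangularizable K H L]
  {S : Finset H.root} {b : (rootSystem H).Base} {φ : L →ₗ[K] SymmetricAlgebra K L} {n : ℕ}

/-- The product in the symmetric algebra of the canonical element of `gradedPiece S 2 ⊗
gradedPiece S (-2)` with `φ` applied to its second factor. -/
noncomputable def contraction (X : DualRootVectors H) (S : Finset H.root)
    (φ : L →ₗ[K] SymmetricAlgebra K L) : SymmetricAlgebra K L :=
  ∑ γ : {γ // corootDegree (rootSystem H) S γ = 2}, ι K L (X.u γ) * φ (X.v γ)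

theorem DualRootVectors.u_mem_gradedPiece_two (X : DualRootVectors H) {γ : H.root}
    (hγ : corootDegree (rootSystem H) S γ = 2) : X.u γ ∈ gradedPiece S 2 := by
  rw [← hγ]
  exact X.u_mem_gradedPiece γ

theorem DualRootVectors.v_mem_gradedPiece_neg_two (X : DualRootVectors H) {γ : H.root}
    (hγ : corootDegree (rootSystem H) S γ = 2) : X.v γ ∈ gradedPiece S (-2) := by
  rw [← hγ]
  exact X.v_mem_gradedPiece γ

theorem IsTwistedEquivariant.lie_contraction (hφ : IsTwistedEquivariant S φ)
    (X : DualRootVectors H) {z : L} (hz : z ∈ gradedPiece S 0) :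
    ⁅z, contraction X S φ⁆ = twist S z • contraction X S φ := by
  have hu (γ : {γ // corootDegree (rootSystem H) S γ = 2}) : ⁅z, X.u γ⁆ ∈ gradedPiece S 2 := by
    simpa using lie_mem_gradedPiece hz (X.u_mem_gradedPiece_two γ.2)
  have hv (γ : {γ // corootDegree (rootSystem H) S γ = 2}) : ⁅z, X.v γ⁆ ∈ gradedPiece S (-2) := by
    simpa using lie_mem_gradedPiece hz (X.v_mem_gradedPiece_neg_two γ.2)
  have hinv := sum_apply_lie_add_sum_apply_lie_eq_zero
    ((LinearMap.mul K (SymmetricAlgebra K L)).compl₁₂ (ι K L) φ) z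
    (fun γ ↦ X.sum_killingForm_v_smul_u two_ne_zero (hu γ))
    (fun γ ↦ X.sum_killingForm_u_smul_v two_ne_zero (hv γ))
  simp only [LinearMap.compl₁₂_apply, LinearMap.mul_apply', ← Finset.sum_add_distrib] at hinv
  have hterm (γ : {γ // corootDegree (rootSystem H) S γ = 2}) :
      ⁅z, ι K L (X.u γ) * φ (X.v γ)⁆ = (ι K L ⁅z, X.u γ⁆ * φ (X.v γ) +
        ι K L (X.u γ) * φ ⁅z, X.v γ⁆) + twist S z • (ι K L (X.u γ) * φ (X.v γ)) := by
    rw [lie_mul, lie_ι, hφ z hz _ (X.v_mem_gradedPiece_neg_two γ.2), mul_sub, mul_smul_comm]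
    abel
  rw [contraction, lie_sum, Finset.sum_congr rfl fun γ _ ↦ hterm γ, Finset.sum_add_distrib, hinv,
    zero_add, Finset.smul_sum]

theorem contraction_mem_map_ι_pow (X : DualRootVectors H)
    (hφ : ∀ y ∈ gradedPiece S (-2), φ y ∈ (gradedPiece S 2).map (ι K L) ^ n) :
    contraction X S φ ∈ (gradedPiece S 2).map (ι K L) ^ (n + 1) := by
  rw [pow_succ']
  exact sum_mem fun γ _ ↦ Submodule.mul_mem_mul
    (Submodule.mem_map_of_mem (X.u_mem_gradedPiece_two γ.2))
    (hφ _ (X.v_mem_gradedPiece_neg_two γ.2))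

theorem isHighestWeightVector_of_mem_map_ι_pow (hS : IsDominantCascade b S)
    {a : SymmetricAlgebra K L} (ha : a ∈ (gradedPiece S 2).map (ι K L) ^ n) (ha₀ : a ≠ 0)
    (hlie : ∀ z ∈ gradedPiece S 0, ⁅z, a⁆ = twist S z • a) :
    IsHighestWeightVector b (rootSum S) a where
  ne_zero := ha₀
  lie_cartan t := by rw [hlie _ (coe_mem_gradedPiece_zero t), twist_coe]
  lie_pos γ hγ z hz := by
    have hzγ := mem_gradedPiece_of_mem_rootSpace_root (S := S) hz
    obtain h₀ | hpos := (hS.corootDegree_nonneg γ hγ).eq_or_lt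
    · rw [hlie z (h₀ ▸ hzγ), twist_root_eq_zero hz, zero_smul]
    · exact lie_eq_zero_of_mem_map_ι_pow
        (fun y hy ↦ hS.lie_eq_zero hzγ hy (lt_of_lt_of_le (by lia) (le_abs_self _))) ha

/-- The sum of the chosen root vectors of the negatives of the roots in `S`. -/
noncomputable def DualRootVectors.vSum (X : DualRootVectors H) (S : Finset H.root) : L :=
  ∑ β ∈ S, X.v β

theorem evalAt_vSum_contraction (X : DualRootVectors H) (hS : IsLongOrthogonal (rootSystem H) S) :
    evalAt (X.vSum S) (contraction X S φ) = ∑ β ∈ S, evalAt (X.vSum S) (φ (X.v β)) := by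
  classical
  have hu (γ : H.root) : killingForm K L (X.vSum S) (X.u γ) = if γ ∈ S then 1 else 0 := by
    rw [DualRootVectors.vSum, map_sum, LinearMap.sum_apply, ← Finset.sum_ite_eq' S γ (fun _ ↦ 1)]
    refine Finset.sum_congr rfl fun β _ ↦ ?_
    split_ifs with h
    · rw [h, X.killingForm_v_u]
    · exact X.killingForm_v_eq_zero (X.u_mem γ) fun h' ↦
        h (Subtype.ext (DFunLike.coe_injective h'.symm))
  have hfilter (γ : H.root) : γ ∈ Finset.univ.filter (corootDegree (rootSystem H) S · = 2) ↔
      corootDegree (rootSystem H) S γ = 2 := Finset.mem_filter_univ γ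
  have hsub : S ⊆ Finset.univ.filter (corootDegree (rootSystem H) S · = 2) := fun β hβ ↦
    (hfilter β).2 (hS.corootDegree_eq_two hβ)
  rw [contraction, map_sum, ← Finset.sum_subtype _ hfilter
    (f := fun γ ↦ evalAt (X.vSum S) (ι K L (X.u γ) * φ (X.v γ))),
    ← Finset.sum_subset hsub fun γ _ hγ ↦ by rw [map_mul, evalAt_ι, hu, if_neg hγ, zero_mul]]
  refine Finset.sum_congr rfl fun β hβ ↦ ?_
  rw [map_mul, evalAt_ι, hu, if_pos hβ, one_mul]

end Contraction

section Connectedness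

open LieAlgebra LieAlgebra.IsKilling LieModule

variable {K L : Type*} [Field K] [CharZero K] [LieRing L] [LieAlgebra K L] [FiniteDimensional K L]
  {H : LieSubalgebra K L} [H.IsCartanSubalgebra] [IsTriangularizable K H L]
  {S : Finset H.root} {β β' δ : H.root}

section IsKilling

variable [IsKilling K L]

theorem apply_cartanEquivDual_symm_ne_zero (h : (rootSystem H).pairingIn ℤ δ β = 1) :
    δ.1 ((cartanEquivDual H).symm β.1.toLinear) ≠ 0 := by
  intro h₀
  have h₂ := two_mul_apply_cartanEquivDual_symm δ.1.toLinear β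
  simp only [Weight.toLinear_apply] at h₂
  rw [h₀, ← coe_pairingIn, h, Int.cast_one, mul_zero, mul_one] at h₂
  exact root_apply_cartanEquivDual_symm_ne_zero (LieSubalgebra.isNonZero_coe_root β) h₂.symm

theorem IsLongRoot.apply_cartanEquivDual_symm_eq (hβ : IsLongRoot (rootSystem H) β)
    (hβ' : IsLongRoot (rootSystem H) β') (h : (rootSystem H).pairingIn ℤ δ β = 1)
    (h' : (rootSystem H).pairingIn ℤ δ β' = 1) :
    δ.1 ((cartanEquivDual H).symm β.1.toLinear) = δ.1 ((cartanEquivDual H).symm β'.1.toLinear) := by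
  have hδ (ξ : H.root) : 2 * δ.1 ((cartanEquivDual H).symm ξ.1.toLinear) =
      δ.1 ((cartanEquivDual H).symm δ.1.toLinear) * (rootSystem H).pairingIn ℤ ξ δ := by
    rw [coe_pairingIn]
    exact (congrArg (2 * ·) (apply_cartanEquivDual_symm_comm δ.1.toLinear ξ.1.toLinear)).trans
      (two_mul_apply_cartanEquivDual_symm ξ.1.toLinear δ)
  refine mul_left_cancel₀ two_ne_zero ?_
  rw [hδ, hδ, hβ.pairingIn_eq_pairingIn hβ' h h']

namespace DualRootVectors

variable (X : DualRootVectors H)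

theorem lie_cartanEquivDual_symm_v (α γ : H.root) :
    ⁅((cartanEquivDual H).symm α.1.toLinear : L), X.v γ⁆ =
      -γ.1 ((cartanEquivDual H).symm α.1.toLinear) • X.v γ :=
  lie_eq_smul_of_mem_rootSpace (X.v_mem γ) _

theorem lie_u_v_eq_zero (hS : IsLongOrthogonal (rootSystem H) S) (hβ : β ∈ S) (hβ' : β' ∈ S)
    (hne : β ≠ β') : ⁅X.u β, X.v β'⁆ = 0 :=
  X.lie_v_eq_zero (X.u_mem β) hne
    ((hS.long β' hβ').root_sub_root_notMem (hS.pairingIn_eq_zero hβ hβ' hne).le)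

theorem lie_lie_u_v_v (hS : IsCascade (rootSystem H) S) (hδ : corootDegree (rootSystem H) S δ = 2)
    (hβ : β ∈ S) : ⁅⁅X.u β, X.v δ⁆, X.v β⁆ =
      -δ.1 ((cartanEquivDual H).symm β.1.toLinear) • X.v δ := by
  have h : ⁅X.v δ, X.v β⁆ = 0 := hS.lie_eq_zero (X.v_mem_gradedPiece_neg_two hδ)
    (X.v_mem_gradedPiece_neg_two (hS.corootDegree_eq_two hβ)) (by norm_num)
  rw [lie_lie, h, lie_zero, zero_sub, X.lie_u_v, lie_skew, lie_cartanEquivDual_symm_v]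

theorem lie_lie_u_v_v_of_ne (hS : IsCascade (rootSystem H) S)
    (hδ : corootDegree (rootSystem H) S δ = 2) (hβ : β ∈ S) (hβ' : β' ∈ S) (hne : β ≠ β') :
    ⁅⁅X.u β, X.v δ⁆, X.v β'⁆ = 0 := by
  have h : ⁅X.v δ, X.v β'⁆ = 0 := hS.lie_eq_zero (X.v_mem_gradedPiece_neg_two hδ)
    (X.v_mem_gradedPiece_neg_two (hS.corootDegree_eq_two hβ')) (by norm_num)
  rw [lie_lie, h, X.lie_u_v_eq_zero hS.toIsLongOrthogonal hβ hβ' hne, lie_zero, lie_zero, sub_zero]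

theorem lie_lie_u_v_vSum (hS : IsCascade (rootSystem H) S)
    (hδ : corootDegree (rootSystem H) S δ = 2) (hβ : β ∈ S) :
    ⁅⁅X.u β, X.v δ⁆, X.vSum S⁆ = -δ.1 ((cartanEquivDual H).symm β.1.toLinear) • X.v δ := by
  rw [vSum, lie_sum, Finset.sum_eq_single_of_mem β hβ fun ξ hξ h ↦
    X.lie_lie_u_v_v_of_ne hS hδ hβ hξ h.symm, X.lie_lie_u_v_v hS hδ hβ]

theorem lie_lie_u_v_u (hS : IsCascade (rootSystem H) S) (hδ : corootDegree (rootSystem H) S δ = 2)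
    (hβ : β ∈ S) : ⁅⁅X.u β, X.v δ⁆, X.u δ⁆ =
      β.1 ((cartanEquivDual H).symm δ.1.toLinear) • X.u β := by
  have h : ⁅X.u β, X.u δ⁆ = 0 := hS.lie_eq_zero
    (X.u_mem_gradedPiece_two (hS.corootDegree_eq_two hβ)) (X.u_mem_gradedPiece_two hδ)
    (by norm_num)
  rw [lie_lie, h, lie_zero, sub_zero, ← lie_skew (X.v δ), X.lie_u_v, lie_neg, lie_skew]
  exact lie_eq_smul_of_mem_rootSpace (X.u_mem β) _

theorem lie_v_lie_v_u (hS : IsCascade (rootSystem H) S) (hδ : corootDegree (rootSystem H) S δ = 2)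
    (hβ : β ∈ S) : ⁅X.v δ, ⁅X.v β, X.u δ⁆⁆ =
      -β.1 ((cartanEquivDual H).symm δ.1.toLinear) • X.v β := by
  have h : ⁅X.v δ, X.v β⁆ = 0 := hS.lie_eq_zero (X.v_mem_gradedPiece_neg_two hδ)
    (X.v_mem_gradedPiece_neg_two (hS.corootDegree_eq_two hβ)) (by norm_num)
  rw [leibniz_lie, h, zero_lie, zero_add, ← lie_skew (X.v δ), X.lie_u_v, lie_neg, lie_skew,
    lie_cartanEquivDual_symm_v]

theorem lie_lie_u_v_lie_v_lie_v_u (hS : IsCascade (rootSystem H) S)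
    (hδ : corootDegree (rootSystem H) S δ = 2) (hβ : β ∈ S) (hβ' : β' ∈ S) (hne : β ≠ β') :
    ⁅⁅X.u β, X.v δ⁆, ⁅X.v β, ⁅X.v β', X.u δ⁆⁆⁆ =
      (δ.1 ((cartanEquivDual H).symm β.1.toLinear) *
        β'.1 ((cartanEquivDual H).symm δ.1.toLinear)) • X.v β' := by
  have hzero : ⁅⁅X.u β, X.v δ⁆, ⁅X.v β', X.u δ⁆⁆ = 0 := by
    rw [leibniz_lie, X.lie_lie_u_v_v_of_ne hS hδ hβ hβ' hne, zero_lie, zero_add,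
      X.lie_lie_u_v_u hS hδ hβ, lie_smul, ← lie_skew,
      X.lie_u_v_eq_zero hS.toIsLongOrthogonal hβ hβ' hne, neg_zero, smul_zero]
  rw [leibniz_lie, hzero, lie_zero, add_zero, X.lie_lie_u_v_v hS hδ hβ, smul_lie,
    X.lie_v_lie_v_u hS hδ hβ', smul_smul, neg_mul_neg]

theorem twist_lie_u_v (hne : β ≠ δ) : twist S ⁅X.u β, X.v δ⁆ = 0 :=
  twist_eq_zero (lie_mem_genWeightSpace_of_mem_genWeightSpace (X.u_mem β) (X.v_mem δ)) fun h ↦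
    hne (Subtype.ext (DFunLike.coe_injective (add_neg_eq_zero.1 h)))

end DualRootVectors

theorem IsTwistedEquivariant.smul_map_v {V : Type*} [AddCommGroup V] [Module K V]
    [LieRingModule L V] {φ : L →ₗ[K] V} (hφ : IsTwistedEquivariant S φ) (X : DualRootVectors H)
    (hS : IsCascade (rootSystem H) S) (hδ : corootDegree (rootSystem H) S δ = 2)
    (hβ : β ∈ S) (hβ' : β' ∈ S) (hne : β ≠ β') (h : (rootSystem H).pairingIn ℤ δ β = 1) :
    (δ.1 ((cartanEquivDual H).symm β.1.toLinear) *
        δ.1 ((cartanEquivDual H).symm β'.1.toLinear)) • φ (X.v β') =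
      ⁅⁅X.u β, X.v δ⁆, φ ⁅X.v β, ⁅X.v β', X.u δ⁆⁆⁆ := by
  have hβm := X.v_mem_gradedPiece_neg_two (hS.corootDegree_eq_two hβ)
  have hβ'm := X.v_mem_gradedPiece_neg_two (hS.corootDegree_eq_two hβ')
  have hy : ⁅X.v β, ⁅X.v β', X.u δ⁆⁆ ∈ gradedPiece S (-2) := by
    simpa using lie_mem_gradedPiece hβm (lie_mem_gradedPiece hβ'm (X.u_mem_gradedPiece_two hδ))
  have hz : ⁅X.u β, X.v δ⁆ ∈ gradedPiece S 0 := by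
    simpa using lie_mem_gradedPiece (X.u_mem_gradedPiece_two (hS.corootDegree_eq_two hβ))
      (X.v_mem_gradedPiece_neg_two hδ)
  have hβδ : β ≠ δ := by
    rintro rfl
    rw [RootPairing.pairingIn_same] at h
    lia
  have hcomm : δ.1 ((cartanEquivDual H).symm β'.1.toLinear) =
      β'.1 ((cartanEquivDual H).symm δ.1.toLinear) :=
    apply_cartanEquivDual_symm_comm δ.1.toLinear β'.1.toLinear
  rw [hcomm, ← map_smul, ← X.lie_lie_u_v_lie_v_lie_v_u hS hδ hβ hβ' hne, hφ _ hz _ hy,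
    X.twist_lie_u_v hβδ, zero_smul, sub_zero]

theorem IsTwistedEquivariant.evalAt_vSum_map_v_eq {φ : L →ₗ[K] SymmetricAlgebra K L}
    (hφ : IsTwistedEquivariant S φ) (X : DualRootVectors H) (hS : IsCascade (rootSystem H) S)
    (hδ : corootDegree (rootSystem H) S δ = 2) (hβ : β ∈ S) (hβ' : β' ∈ S) (hne : β ≠ β')
    (h : (rootSystem H).pairingIn ℤ δ β = 1) (h' : (rootSystem H).pairingIn ℤ δ β' = 1) :
    evalAt (X.vSum S) (φ (X.v β)) = evalAt (X.vSum S) (φ (X.v β')) := by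
  have hvv : ⁅X.v β, X.v β'⁆ = 0 := hS.lie_eq_zero
    (X.v_mem_gradedPiece_neg_two (hS.corootDegree_eq_two hβ))
    (X.v_mem_gradedPiece_neg_two (hS.corootDegree_eq_two hβ')) (by norm_num)
  have hy : ⁅X.v β', ⁅X.v β, X.u δ⁆⁆ = ⁅X.v β, ⁅X.v β', X.u δ⁆⁆ := by
    rw [leibniz_lie (X.v β), hvv, zero_lie, zero_add]
  have hstab : ⁅⁅X.u β', X.v δ⁆ - ⁅X.u β, X.v δ⁆, X.vSum S⁆ = 0 := by
    rw [sub_lie, X.lie_lie_u_v_vSum hS hδ hβ', X.lie_lie_u_v_vSum hS hδ hβ,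
      (hS.long β hβ).apply_cartanEquivDual_symm_eq (hS.long β' hβ') h h', sub_self]
  have hβy := hφ.smul_map_v X hS hδ hβ' hβ hne.symm h'
  have hβ'y := hφ.smul_map_v X hS hδ hβ hβ' hne h
  rw [hy, mul_comm] at hβy
  have hsub := evalAt_lie hstab (φ ⁅X.v β, ⁅X.v β', X.u δ⁆⁆)
  rw [sub_lie, ← hβy, ← hβ'y, ← smul_sub, map_smul, map_sub, smul_eq_mul, mul_eq_zero] at hsub
  exact sub_eq_zero.1 (hsub.resolve_left
    (mul_ne_zero (apply_cartanEquivDual_symm_ne_zero h) (apply_cartanEquivDual_symm_ne_zero h')))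

end IsKilling

theorem IsCascade.eq_of_forall_pairingIn_eq_one [LieAlgebra.IsSimple K L]
    (hS : IsCascade (rootSystem H) S) {f : H.root → K}
    (hf : ∀ β ∈ S, ∀ β' ∈ S, ∀ δ, β ≠ β' → corootDegree (rootSystem H) S δ = 2 →
      (rootSystem H).pairingIn ℤ δ β = 1 → (rootSystem H).pairingIn ℤ δ β' = 1 → f β = f β')
    (hβ : β ∈ S) (hβ' : β' ∈ S) : f β = f β' := by
  obtain ⟨X⟩ : Nonempty (DualRootVectors H) := inferInstance
  let h : H := ∑ ξ ∈ S, f ξ • coroot ξ.1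
  have happly (γ : H.root) :
      γ.1 h = ∑ ξ ∈ S, (rootSystem H).pairingIn ℤ γ ξ • f ξ := by
    refine (map_sum γ.1.toLinear _ _).trans (Finset.sum_congr rfl fun ξ _ ↦ ?_)
    rw [map_smul, Weight.toLinear_apply, ← coe_pairingIn, zsmul_eq_mul, smul_eq_mul, mul_comm]
  have hzero {z : L} (hz : z ∈ gradedPiece S 0) : ⁅(h : L), z⁆ = 0 := by
    have hle : gradedPiece S 0 ≤ LinearMap.ker (ad K L (h : L)) := by
      refine gradedPiece_le (fun γ hγ x hx ↦ ?_) fun _ t ↦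
        congrArg Subtype.val (trivial_lie_zero H H h t)
      have hγh : γ.1 h = 0 := (happly γ).trans (hS.sum_pairingIn_smul_eq_zero hf hγ)
      exact (lie_eq_smul_of_mem_rootSpace hx h).trans (by rw [hγh, zero_smul])
    exact hle hz
  have hv {ξ : H.root} (hξ : ξ ∈ S) : ⁅(h : L), X.v ξ⁆ = (-2 * f ξ) • X.v ξ := by
    have hξh : ξ.1 h = 2 * f ξ := by
      rw [happly, Finset.sum_eq_single_of_mem ξ hξ fun ζ hζ hne ↦ by
        rw [hS.pairingIn_eq_zero hξ hζ hne.symm, zero_smul], RootPairing.pairingIn_same,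
        zsmul_eq_mul, Int.cast_ofNat]
    refine (lie_eq_smul_of_mem_rootSpace (X.v_mem ξ) h).trans ?_
    rw [Pi.neg_apply, hξh, neg_mul]
  let Y := gradedPiece S (-2) ⊓ (ad K L (h : L)).eigenspace (-2 * f β')
  have hmem {ξ : H.root} (hξ : ξ ∈ S) : X.v ξ ∈ gradedPiece S (-2) :=
    X.v_mem_gradedPiece_neg_two (hS.corootDegree_eq_two hξ)
  have hle : gradedPiece S (-2) ≤ Y := by
    refine hS.gradedPiece_neg_two_le inf_le_left (fun z hz y hy ↦ ⟨?_, ?_⟩)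
      ⟨hmem hβ', Module.End.mem_eigenspace_iff.2 (hv hβ')⟩ (X.v_ne_zero β')
    · simpa using lie_mem_gradedPiece hz hy.1
    · have hyh : ⁅(h : L), y⁆ = (-2 * f β') • y := Module.End.mem_eigenspace_iff.1 hy.2
      refine Module.End.mem_eigenspace_iff.2 ?_
      rw [ad_apply, leibniz_lie, hzero hz, zero_lie, zero_add, hyh, lie_smul]
  have heq : (-2 * f β) • X.v β = (-2 * f β') • X.v β :=
    (hv hβ).symm.trans (Module.End.mem_eigenspace_iff.1 (hle (hmem hβ)).2)
  exact mul_left_cancel₀ (by norm_num) (smul_left_injective K (X.v_ne_zero β) heq)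

end Connectedness

section CascadeVectors

open LieAlgebra LieAlgebra.IsKilling LieModule SymmetricAlgebra

variable {K L : Type*} [Field K] [CharZero K] [LieRing L] [LieAlgebra K L] [FiniteDimensional K L]
  {H : LieSubalgebra K L} [H.IsCartanSubalgebra] [IsTriangularizable K H L]
  {S : Finset H.root}

section IsKilling

variable [IsKilling K L] {b : (rootSystem H).Base} {X : DualRootVectors H} {α : H.root}
  {hα : α ∉ S} {F : SymmetricAlgebra K L}

theorem IsLongOrthogonal.isDominantCascade (hS : IsLongOrthogonal (rootSystem H) S) (hα : α ∈ S)
    (hhigh : IsHighestRoot b α) (hdom : IsDominant b (rootSum S)) : IsDominantCascade b S where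
  toIsCascade := hS.isCascade hα hhigh hdom
  corootDegree_nonneg _ hγ := hS.corootDegree_nonneg hdom hγ

variable (b) in
theorem isDominantCascade_empty : IsDominantCascade b ∅ where
  long := by simp
  isOrthogonal := by simp
  corootDegree_le_two := by simp [corootDegree]
  corootDegree_nonneg := by simp [corootDegree]

/-- The highest weight vectors of weight `rootSum S` carried along the induction: sums of products
of `S.card` elements of degree two that, as polynomial functions on `L`, do not vanish at
`X.vSum S`. -/
structure IsCascadeVector (X : DualRootVectors H) (b : (rootSystem H).Base) (S : Finset H.root)
    (F : SymmetricAlgebra K L) : Prop extends IsHighestWeightVector b (rootSum S) F where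
  mem_map_ι_pow : F ∈ (gradedPiece S 2).map (ι K L) ^ S.card
  evalAt_ne_zero : evalAt (X.vSum S) F ≠ 0

variable (b X) in
theorem isCascadeVector_one : IsCascadeVector X b ∅ 1 where
  ne_zero := one_ne_zero
  lie_cartan t := by rw [lie_one, rootSum, Finset.sum_empty, LinearMap.zero_apply, zero_smul]
  lie_pos _ _ x _ := lie_one x
  mem_map_ι_pow := by
    rw [Finset.card_empty, pow_zero]
    exact Submodule.one_le.1 le_rfl
  evalAt_ne_zero := by simp

namespace IsCascadeVector

theorem lieSpan_le (hF : IsCascadeVector X b S F) :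
    LieSubmodule.lieSpan K L {F} ≤ symPow K L L S.card :=
  LieSubmodule.lieSpan_le.2
    (Set.singleton_subset_iff.2 (mem_symPow_of_mem_map_ι_pow L hF.mem_map_ι_pow))

theorem finiteDimensional_lieSpan (hF : IsCascadeVector X b S F) :
    FiniteDimensional K (LieSubmodule.lieSpan K L {F}) :=
  have : FiniteDimensional K (symPow K L L S.card).toSubmodule :=
    inferInstanceAs (Module.Finite K (symPow K L L S.card))
  Submodule.finiteDimensional_of_le (S₂ := (symPow K L L S.card).toSubmodule) hF.lieSpan_le

theorem evalAt_vSum_cons (hF : IsCascadeVector X b S F)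
    (hS : IsLongOrthogonal (rootSystem H) (S.cons α hα)) :
    evalAt (X.vSum (S.cons α hα)) F = evalAt (X.vSum S) F := by
  have hα₀ : corootDegree (rootSystem H) S α = 0 := by
    have h := hS.corootDegree_eq_two (Finset.mem_cons_self α S)
    rw [corootDegree_cons, RootPairing.pairingIn_same] at h
    lia
  have hle : gradedPiece S 2 ≤ LinearMap.ker (killingForm K L (X.v α)) := by
    refine gradedPiece_le (fun γ hγ x hx ↦ X.killingForm_v_eq_zero hx fun h ↦ ?_) (by simp)
    rw [Subtype.ext (DFunLike.coe_injective h), hα₀] at hγ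
    exact two_ne_zero hγ.symm
  refine algHom_eq_of_mem_map_ι_pow (fun y hy ↦ ?_) hF.mem_map_ι_pow
  have hy₀ : killingForm K L (X.v α) y = 0 := hle hy
  rw [evalAt_ι, evalAt_ι, DualRootVectors.vSum, Finset.sum_cons, map_add, LinearMap.add_apply, hy₀,
    zero_add, DualRootVectors.vSum]

end IsCascadeVector

end IsKilling

variable [LieAlgebra.IsSimple K L] {b : (rootSystem H).Base} {X : DualRootVectors H}
  {α : H.root} {hα : α ∉ S} {F : SymmetricAlgebra K L}
  {φ : L →ₗ[K] SymmetricAlgebra K L}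

theorem IsTwistedEquivariant.evalAt_vSum_contraction (hφ : IsTwistedEquivariant S φ)
    (X : DualRootVectors H) (hS : IsCascade (rootSystem H) S) (hα : α ∈ S) :
    evalAt (X.vSum S) (contraction X S φ) = S.card • evalAt (X.vSum S) (φ (X.v α)) := by
  rw [SymLie.evalAt_vSum_contraction X hS.toIsLongOrthogonal, Finset.sum_congr rfl fun β hβ ↦
    hS.eq_of_forall_pairingIn_eq_one (f := fun β ↦ evalAt (X.vSum S) (φ (X.v β)))
      (fun _ hβ _ hβ' _ hne hδ h h' ↦ hφ.evalAt_vSum_map_v_eq X hS hδ hβ hβ' hne h h') hβ hα,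
    Finset.sum_const]

theorem IsCascadeVector.exists_cons (hF : IsCascadeVector X b S F) (hS : IsDominantCascade b S)
    (hS' : IsDominantCascade b (S.cons α hα)) : ∃ F', IsCascadeVector X b (S.cons α hα) F' := by
  have hαS : α ∈ S.cons α hα := Finset.mem_cons_self α S
  have := hF.finiteDimensional_lieSpan
  obtain ⟨φ, hφα, hφ⟩ := exists_isTwistedEquivariant X hS.corootDegree_nonneg hS'
    hF.toIsHighestWeightVector
  have hmem : φ (X.v α) ∈ (gradedPiece (S.cons α hα) 2).map (ι K L) ^ S.card := by
    rw [hφα]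
    exact pow_le_pow_left' (Submodule.map_mono hS'.gradedPiece_two_le_cons) _ hF.mem_map_ι_pow
  have hmem' : contraction X (S.cons α hα) φ ∈
      (gradedPiece (S.cons α hα) 2).map (ι K L) ^ (S.card + 1) :=
    contraction_mem_map_ι_pow X fun y hy ↦ hφ.map_mem hS'.toIsCascade
      (fun z hz a ha ↦ lie_mem_map_ι_pow (fun y hy ↦ by simpa using lie_mem_gradedPiece hz hy) ha)
      (X.v_mem_gradedPiece_neg_two (hS'.corootDegree_eq_two hαS)) (X.v_ne_zero α) hmem hy
  have heval : evalAt (X.vSum (S.cons α hα)) (contraction X (S.cons α hα) φ) ≠ 0 := by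
    rw [hφ.evalAt_vSum_contraction X hS'.toIsCascade hαS, hφα,
      hF.evalAt_vSum_cons hS'.toIsLongOrthogonal]
    exact smul_ne_zero (Finset.card_ne_zero_of_mem hαS) hF.evalAt_ne_zero
  have hne : contraction X (S.cons α hα) φ ≠ 0 := fun h ↦ heval (by rw [h, map_zero])
  exact ⟨_, isHighestWeightVector_of_mem_map_ι_pow hS' hmem' hne
    fun z hz ↦ hφ.lie_contraction X hz, by rwa [Finset.card_cons], heval⟩

variable {k : ℕ} {β : ℕ → H.root}

theorem isLongRoot_and_isOrthogonal_succ (hβ₁ : IsHighestRoot b (β 1))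
    (hβ : ∀ i, 1 ≤ i → i < k → IsLongRoot (rootSystem H) (β (i + 1)) ∧
      ∀ γ ∈ β '' Set.Icc 1 i, (rootSystem H).IsOrthogonal (β (i + 1)) γ)
    (hσ : ∀ i, 1 ≤ i → i ≤ k → IsDominant b (∑ j ∈ Finset.Icc 1 i, (rootSystem H).root (β j)))
    {i : ℕ} (hi : i < k) : IsLongRoot (rootSystem H) (β (i + 1)) ∧
      ∀ γ ∈ β '' Set.Icc 1 i, (rootSystem H).IsOrthogonal (β (i + 1)) γ := by
  obtain rfl | hi₀ := Nat.eq_zero_or_pos i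
  · have hdom : IsDominant b (∑ γ ∈ {β 1}, (rootSystem H).root γ) := by
      simpa using hσ 1 le_rfl hi
    refine ⟨hβ₁.isLongRoot fun i hi ↦ ?_, by simp⟩
    simpa using isDominant_sum_root_iff.1 hdom i hi
  · exact hβ i hi₀ hi

theorem exists_isCascadeVector (X : DualRootVectors H) (hβ₁ : IsHighestRoot b (β 1))
    (hβ : ∀ i, 1 ≤ i → i < k → IsLongRoot (rootSystem H) (β (i + 1)) ∧
      ∀ γ ∈ β '' Set.Icc 1 i, (rootSystem H).IsOrthogonal (β (i + 1)) γ)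
    (hσ : ∀ i, 1 ≤ i → i ≤ k → IsDominant b (∑ j ∈ Finset.Icc 1 i, (rootSystem H).root (β j)))
    {i : ℕ} (hi : i ≤ k) :
    ∃ (S : Finset H.root) (F : SymmetricAlgebra K L), (S : Set H.root) = β '' Set.Icc 1 i ∧
      S.card = i ∧ rootSum S = ∑ j ∈ Finset.Icc 1 i, (rootSystem H).root (β j) ∧
      IsDominantCascade b S ∧ IsCascadeVector X b S F := by
  induction i with
  | zero => exact ⟨∅, 1, by simp, rfl, rfl, isDominantCascade_empty b, isCascadeVector_one b X⟩
  | succ i ih =>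
    obtain ⟨S, F, hcoe, hcard, hsum, hS, hF⟩ := ih (Nat.le_of_succ_le hi)
    obtain ⟨hlong, hort⟩ := isLongRoot_and_isOrthogonal_succ hβ₁ hβ hσ hi
    rw [← hcoe] at hort
    have hα : β (i + 1) ∉ S := fun h ↦ by
      simpa using pairingIn_eq_zero_of_isOrthogonal (hort _ h)
    have hcoe' : (S.cons (β (i + 1)) hα : Set H.root) = β '' Set.Icc 1 (i + 1) := by
      rw [Finset.coe_cons, hcoe, ← Set.image_insert_eq, Set.insert_Icc_right_eq_Icc_add_one]
      lia
    have hsum' : rootSum (S.cons (β (i + 1)) hα) =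
        ∑ j ∈ Finset.Icc 1 (i + 1), (rootSystem H).root (β j) := by
      rw [rootSum, Finset.sum_cons, ← rootSum, hsum, Finset.sum_Icc_succ_top (by lia), add_comm]
    have hβ₁S : β 1 ∈ S.cons (β (i + 1)) hα := by
      rw [← Finset.mem_coe, hcoe']
      exact ⟨1, by simp, rfl⟩
    have hS' : IsDominantCascade b (S.cons (β (i + 1)) hα) :=
      (hS.toIsLongOrthogonal.cons hlong hort).isDominantCascade hβ₁S hβ₁
        (hsum' ▸ hσ (i + 1) (by lia) hi)
    obtain ⟨F', hF'⟩ := hF.exists_cons hS hS'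
    exact ⟨_, F', hcoe', by rw [Finset.card_cons, hcard], hsum', hS', hF'⟩

end CascadeVectors

end SymLie

open LieAlgebra.IsKilling in
theorem proposition6p1_general {K L : Type*} [Field K] [CharZero K] [LieRing L] [LieAlgebra K L]
    [FiniteDimensional K L] [LieAlgebra.IsSimple K L] (H : LieSubalgebra K L)
    [H.IsCartanSubalgebra] [LieModule.IsTriangularizable K H L] (b : (rootSystem H).Base)
    (k : ℕ) (β : ℕ → H.root) (hβ₁ : SymLie.IsHighestRoot b (β 1))
    (hβ : ∀ i, 1 ≤ i → i < k → SymLie.IsLongRoot (rootSystem H) (β (i + 1)) ∧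
      ∀ γ ∈ β '' Set.Icc 1 i, (rootSystem H).IsOrthogonal (β (i + 1)) γ)
    (hσ : ∀ i, 1 ≤ i → i ≤ k →
      SymLie.IsDominant b (∑ j ∈ Finset.Icc 1 i, (rootSystem H).root (β j))) :
    ∃ W : LieSubmodule K L (SymmetricAlgebra K L), W ≤ SymLie.symPow K L L k ∧
      SymLie.IsIrreducibleWithHighestWeight b W
        (∑ j ∈ Finset.Icc 1 k, (rootSystem H).root (β j)) := by
  obtain ⟨X⟩ : Nonempty (SymLie.DualRootVectors H) := inferInstance
  obtain ⟨S, F, -, hcard, hsum, -, hF⟩ := SymLie.exists_isCascadeVector X hβ₁ hβ hσ le_rfl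
  have := hF.finiteDimensional_lieSpan
  refine ⟨LieSubmodule.lieSpan K L {F}, hcard ▸ hF.lieSpan_le, ?_⟩
  rw [← hsum]
  exact hF.isIrreducibleWithHighestWeight_lieSpan

theorem proposition6p1 {L : Type*} [LieRing L] [LieAlgebra ℂ L] [FiniteDimensional ℂ L]
    [LieAlgebra.IsSimple ℂ L] (H : LieSubalgebra ℂ L) [H.IsCartanSubalgebra]
    (b : (LieAlgebra.IsKilling.rootSystem H).Base)
    (k : ℕ) (hk : 1 ≤ k) (β : ℕ → H.root)
    (hβ₁ : SymLie.IsHighestRoot b (β 1))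
    (hβ : ∀ i, 1 ≤ i → i < k →
      SymLie.IsHighestLongRootOrthogonalTo b (β '' Set.Icc 1 i) (β (i + 1)))
    (hσ : ∀ i, 1 ≤ i → i ≤ k →
      SymLie.IsDominant b (∑ j ∈ Finset.Icc 1 i, (LieAlgebra.IsKilling.rootSystem H).root (β j))) :
    ∃ W : LieSubmodule ℂ L (SymmetricAlgebra ℂ L), W ≤ SymLie.symPow ℂ L L k ∧
      SymLie.IsIrreducibleWithHighestWeight b W
        (∑ j ∈ Finset.Icc 1 k, (LieAlgebra.IsKilling.rootSystem H).root (β j)) :=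
  proposition6p1_general H b k β hβ₁
    (fun i hi hik ↦ ⟨(hβ i hi hik).1, (hβ i hi hik).2.1⟩) hσ
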